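/- **Definitions.** For a probability space $(\Omega,\mathcal A,\mu)$, a *$P$-operator* on $\Omega$ is a linear operator $A:L^\infty(\Omega)\to L^1(\Omega)$, written $v\mapsto vA$, with $\|A\|_{\infty\to1}<\infty$. It is *self-adjoint* if $\mathbb E((vA)w)=\mathbb E((wA)v)$ for all $v,w\in L^\infty(\Omega)$, *positivity-preserving* if $v\ge 0$ a.e. implies $vA\ge 0$ a.e., and *$1$-regular* if $1_\Omega A=1_\Omega$. A *Markov graphop* is a positivity-preserving, self-adjoint, $1$-regular $P$-operator. For $k\in\mathbb N$ the *$k$-profile* $\mathcal S_k(A)$ is the set of all joint distributions of $(v_1,\dots,v_k,v_1A,\dots,v_kA)$, where $v_1,\dots,v_k\in L^\infty(\Omega)$ take values in $[-1,1]$; it is a set of Borel probability measures on $\mathbb R^{2k}$. Let $d_H$ be the Hausdorff distance of such sets with respect to the Lévy–Prokhorov metric, and for $P$-operators $A,B$ (possibly on different probability spaces) let $$d_M(A,B)=\sum_{k=1}^\infty 2^{-k}\,d_H(\mathcal S_k(A),\mathcal S_k(B)).$$ $A$ and $B$ are *weakly equivalent* if $d_M(A,B)=0$, so $d_M$ induces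 a metric on weak equivalence classes. A sequence $(A_i)$ of $P$-operators is *action convergent* if $(\mathcal S_k(A_i))_i$ is a Cauchy sequence in $d_H$ for every $k\in\mathbb N$. For a finite simple graph $G$ with at least one edge, let $d(i)$ be the degree of vertex $i$ and let $\nu_G(i)=d(i)/(2|E(G)|)$, a probability measure on $V(G)$. The random walk operator $M(G)$ is the $P$-operator on $(V(G),\nu_G)$ given by $(vM(G))(i)=d(i)^{-1}\sum_{j:\,(i,j)\in E(G)}v(j)$ for $i$ in the support of $\nu_G$. A sequence $(G_i)$ of such graphs is *random walk convergent* if $(M(G_i))$ is action convergent. **Theorem.** 1. The set $\mathcal M$ of weak equivalence classes of Markov graphops is compact in the metric $d_M$. 2. Every sequence $(G_i)$ of finite graphs, each with at least one edge, has a random walk convergent subsequence. 3. If a sequence $(G_i)$ of finite graphs, each with at least one edge, is random walk convergent, then there is a Markov graphop $A$ with $\lim_{i\to\infty}d_M(M(G_i),A)=0$; moreover, every $P$-operator $A$ with $\lim_{i\to\infty}d_M(M(G_i),A)=0$ is a Markov graphop. -/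

import Mathlib

open MeasureTheory Filter Topology
open scoped ENNReal

universe u

/-! ### P-operators on a fixed probability space -/

section Operators

variable {Ω : Type u} [MeasurableSpace Ω]

/-- P-operators on `(Ω, μ)`: linear operators `L^∞(Ω) → L^1(Ω)` with finite `‖·‖_{∞→1}` norm. -/
abbrev POp (μ : Measure Ω) : Type u := Lp ℝ ∞ μ →L[ℝ] Lp ℝ 1 μ

variable {μ : Measure Ω}

/-- The bilinear form `(v, w)_A = E((vA) w)`. -/
noncomputable def POp.form (A : POp μ) (v w : Lp ℝ ∞ μ) : ℝ := ∫ x, A v x * w x ∂μ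

def POp.IsSelfAdjoint (A : POp μ) : Prop := ∀ v w : Lp ℝ ∞ μ, A.form v w = A.form w v

def POp.IsPositivityPreserving (A : POp μ) : Prop :=
  ∀ v : Lp ℝ ∞ μ, (∀ᵐ x ∂μ, 0 ≤ v x) → ∀ᵐ x ∂μ, 0 ≤ A v x

variable [IsProbabilityMeasure μ]

/-- `A` is `c`-regular if `1_Ω A = c 1_Ω`. -/
def POp.IsRegular (A : POp μ) (c : ℝ) : Prop := A (Lp.const ∞ μ 1) = Lp.const 1 μ c

/-- A graphop is a positivity-preserving self-adjoint P-operator;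
a Markov graphop is a 1-regular graphop. -/
structure POp.IsMarkovGraphop (A : POp μ) : Prop where
  positivityPreserving : A.IsPositivityPreserving
  selfAdjoint : A.IsSelfAdjoint
  regular : A.IsRegular 1

/-- The joint distribution `D_A(v_1, …, v_k)` of `v_1, …, v_k, v_1 A, …, v_k A`, as a Borel
probability measure on `ℝ^{2k}` (with its Euclidean distance).  The coordinates in the first copy
of `Fin k` are the `v_i`, those in the second copy are the `v_i A`. -/
noncomputable def POp.jointLaw (A : POp μ) {k : ℕ} (v : Fin k → Lp ℝ ∞ μ) :
    ProbabilityMeasure (EuclideanSpace ℝ (Fin k ⊕ Fin k)) :=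
  ⟨μ.map fun x => WithLp.toLp 2 (Sum.elim (fun i => v i x) (fun i => A (v i) x)),
    Measure.isProbabilityMeasure_map (by
      refine (WithLp.measurable_toLp 2 _).comp_aemeasurable
        (aemeasurable_pi_lambda _ fun i => ?_)
      cases i with
      | inl i => exact (Lp.aestronglyMeasurable (v i)).aemeasurable
      | inr i => exact (Lp.aestronglyMeasurable (A (v i))).aemeasurable)⟩

/-- The `k`-profile `S_k(A)`, as a set in the Lévy–Prokhorov metric space of Borel probability
measures on `ℝ^{2k}`: all `D_A(v_1, …, v_k)` with `v_1, …, v_k` taking values in `[-1, 1]`. -/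
noncomputable def POp.profile (A : POp μ) (k : ℕ) :
    Set (LevyProkhorov (ProbabilityMeasure (EuclideanSpace ℝ (Fin k ⊕ Fin k)))) :=
  {ρ | ∃ v : Fin k → Lp ℝ ∞ μ, (∀ i, ∀ᵐ x ∂μ, v i x ∈ Set.Icc (-1 : ℝ) 1) ∧
    ρ = LevyProkhorov.ofMeasure (A.jointLaw v)}

theorem POp.profile_nonempty (A : POp μ) (k : ℕ) : (A.profile k).Nonempty := by
  refine ⟨_, fun _ => 0, fun i => ?_, rfl⟩
  filter_upwards [Lp.coeFn_zero ℝ ∞ μ] with x hx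
  exact hx ▸ (by simp)

end Operators

/-! ### P-operators on varying probability spaces, and the metric of action convergence -/

/-- A P-operator, together with the probability space on which it acts. -/
structure POperator : Type (u + 1) where
  Ω : Type u
  [mΩ : MeasurableSpace Ω]
  μ : Measure Ω
  [prob : IsProbabilityMeasure μ]
  op : POp μ

attribute [instance] POperator.mΩ POperator.prob

def POperator.IsMarkovGraphop (A : POperator.{u}) : Prop := A.op.IsMarkovGraphop

noncomputable def POperator.profile (A : POperator.{u}) (k : ℕ) :
    Set (LevyProkhorov (ProbabilityMeasure (EuclideanSpace ℝ (Fin k ⊕ Fin k)))) := A.op.profile k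

/-- The Hausdorff distance `d_H(S_k(A), S_k(B))` of the `k`-profiles, with respect to the
Lévy–Prokhorov metric.  (All Lévy–Prokhorov distances are at most `1`, so it is finite.) -/
noncomputable def profileDist (k : ℕ) (A B : POperator.{u}) : ℝ :=
  Metric.hausdorffDist (A.profile k) (B.profile k)

/-- `d_M(A, B) = ∑_{k ≥ 1} 2^{-k} d_H(S_k(A), S_k(B))`. -/
noncomputable def dM (A B : POperator.{u}) : ℝ :=
  ∑' k : ℕ, (1 / 2 : ℝ) ^ (k + 1) * profileDist (k + 1) A B

/-- A sequence of P-operators is action convergent if for every `k` the sequence of its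
`k`-profiles is a Cauchy sequence in `d_H`. -/
def ActionConvergent (A : ℕ → POperator.{u}) : Prop :=
  ∀ k : ℕ, ∀ ε > 0, ∃ N, ∀ m ≥ N, ∀ n ≥ N, profileDist k (A m) (A n) < ε

theorem levyProkhorov_edist_le_one {X : Type*} [PseudoMetricSpace X] [MeasurableSpace X]
    [OpensMeasurableSpace X] (ρ σ : LevyProkhorov (ProbabilityMeasure X)) : edist ρ σ ≤ 1 := by
  rw [LevyProkhorov.edist_probabilityMeasure_def]
  refine (levyProkhorovEDist_le_max_measure_univ _ _).trans ?_
  simp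

theorem hausdorffEDist_profile_le_one (k : ℕ) (A B : POperator.{u}) :
    Metric.hausdorffEDist (A.profile k) (B.profile k) ≤ 1 := by
  obtain ⟨a, ha⟩ := POp.profile_nonempty A.op k
  obtain ⟨b, hb⟩ := POp.profile_nonempty B.op k
  exact Metric.hausdorffEDist_le_of_mem_edist
    (fun x _ => ⟨b, hb, levyProkhorov_edist_le_one x b⟩)
    (fun x _ => ⟨a, ha, levyProkhorov_edist_le_one x a⟩)

theorem profileDist_nonneg (k : ℕ) (A B : POperator.{u}) : 0 ≤ profileDist k A B :=
  Metric.hausdorffDist_nonneg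

theorem profileDist_le_one (k : ℕ) (A B : POperator.{u}) : profileDist k A B ≤ 1 :=
  ENNReal.toReal_le_of_le_ofReal zero_le_one (by simpa using hausdorffEDist_profile_le_one k A B)

theorem profileDist_triangle (k : ℕ) (A B C : POperator.{u}) :
    profileDist k A C ≤ profileDist k A B + profileDist k B C :=
  Metric.hausdorffDist_triangle
    (ne_top_of_le_ne_top ENNReal.one_ne_top (hausdorffEDist_profile_le_one k A B))

theorem dM_summable (A B : POperator.{u}) :
    Summable fun k : ℕ => (1 / 2 : ℝ) ^ (k + 1) * profileDist (k + 1) A B := by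
  refine Summable.of_nonneg_of_le
    (fun k => mul_nonneg (by positivity) (profileDist_nonneg _ _ _))
    (fun k => mul_le_of_le_one_right (by positivity) (profileDist_le_one _ _ _))
    ((summable_nat_add_iff 1).2 (summable_geometric_of_lt_one (by norm_num) (by norm_num)))

/-- `d_M` is a pseudometric on the class of all P-operators. -/
noncomputable instance POperator.instPseudoMetricSpace : PseudoMetricSpace POperator.{u} where
  dist := dM
  dist_self A := by simp [dM, profileDist]
  dist_comm A B := by simp [dM, profileDist, Metric.hausdorffDist_comm]
  dist_triangle A B C := by
    rw [dM, dM, dM, ← (dM_summable A B).tsum_add (dM_summable B C)]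
    refine (dM_summable A C).tsum_le_tsum (fun k => ?_) ((dM_summable A B).add (dM_summable B C))
    rw [← mul_add]
    exact mul_le_mul_of_nonneg_left (profileDist_triangle _ _ _ _) (by positivity)

/-- The space of weak equivalence classes of P-operators, where `A` and `B` are weakly equivalent
if `d_M(A, B) = 0`.  It carries the metric induced by `d_M`, see the next two lemmas. -/
abbrev WeakClass : Type (u + 1) := SeparationQuotient POperator.{u}

theorem WeakClass.mk_eq_mk_iff (A B : POperator.{u}) :
    (SeparationQuotient.mk A : WeakClass.{u}) = SeparationQuotient.mk B ↔ dM A B = 0 :=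
  SeparationQuotient.mk_eq_mk.trans Metric.inseparable_iff

theorem WeakClass.dist_mk_mk (A B : POperator.{u}) :
    dist (SeparationQuotient.mk A : WeakClass.{u}) (SeparationQuotient.mk B) = dM A B := rfl

/-- The set of weak equivalence classes of Markov graphops. -/
def markovClasses : Set WeakClass.{u} :=
  {a | ∃ A : POperator.{u}, A.IsMarkovGraphop ∧ SeparationQuotient.mk A = a}

/-! ### The random walk operator of a finite graph -/

section Graphs

variable {V : Type u} [Fintype V]

open scoped Classical in
/-- The stationary measure `ν_G` of the random walk: `ν_G(i) = d(i) / (2 |E(G)|)`. -/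
noncomputable def rwMeasure [MeasurableSpace V] (G : SimpleGraph V) : Measure V :=
  ∑ i, ENNReal.ofReal ((G.degree i : ℝ) / (2 * (G.edgeFinset.card : ℝ))) • Measure.dirac i

open scoped Classical in
/-- The function `i ↦ d(i)⁻¹ ∑_{(i,j) ∈ E(G)} v(j)`. -/
noncomputable def rwAverage (G : SimpleGraph V) (v : V → ℝ) (i : V) : ℝ :=
  (G.degree i : ℝ)⁻¹ * ∑ j ∈ G.neighborFinset i, v j

variable [MeasurableSpace V]

theorem rwMeasure_isProbability (G : SimpleGraph V) (hG : G.edgeSet.Nonempty) :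
    IsProbabilityMeasure (rwMeasure G) := by
  classical
  have hE : 0 < G.edgeFinset.card := Finset.card_pos.2 (by simpa using hG)
  have hE' : (0 : ℝ) < G.edgeFinset.card := by exact_mod_cast hE
  constructor
  simp only [rwMeasure, Measure.coe_finsetSum, Finset.sum_apply, Measure.smul_apply,
    measure_univ, smul_eq_mul, mul_one]
  rw [← ENNReal.ofReal_sum_of_nonneg (fun i _ => by positivity), ← Finset.sum_div]
  have h := G.sum_degrees_eq_twice_card_edges
  have h2 : (∑ i, (G.degree i : ℝ)) = 2 * (G.edgeFinset.card : ℝ) := by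
    exact_mod_cast (by convert h)
  convert ENNReal.ofReal_one
  rw [div_eq_one_iff_eq (by positivity)]
  convert h2

instance rwMeasure_isFinite (G : SimpleGraph V) : IsFiniteMeasure (rwMeasure G) := by
  constructor
  simp [rwMeasure, ENNReal.sum_lt_top]

variable [DiscreteMeasurableSpace V]

theorem ae_rwMeasure_iff (G : SimpleGraph V) (P : V → Prop) :
    (∀ᵐ i ∂rwMeasure G, P i) ↔ ∀ i j, G.Adj i j → P i := by
  classical
  have key : ∀ i, (0 < (G.degree i : ℝ) / (2 * (G.edgeFinset.card : ℝ))) ↔ ∃ j, G.Adj i j := by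
    intro i
    rw [← G.degree_pos_iff_exists_adj]
    constructor
    · intro h
      by_contra h0
      have : G.degree i = 0 := by omega
      simp [this] at h
    · intro h
      obtain ⟨j, hj⟩ := (G.degree_pos_iff_exists_adj i).1 h
      have hE : 0 < G.edgeFinset.card :=
        Finset.card_pos.2 ⟨s(i, j), by simpa using hj⟩
      positivity
  rw [ae_iff, rwMeasure]
  simp only [Measure.coe_finsetSum, Finset.sum_apply, Measure.smul_apply, smul_eq_mul,
    Finset.sum_eq_zero_iff, Finset.mem_univ, true_implies, mul_eq_zero, ENNReal.ofReal_eq_zero]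
  refine forall_congr' fun i => ?_
  rw [← not_lt]
  have hd : (Measure.dirac i {a | ¬ P a} = 0) ↔ P i := by
    simp [Measure.dirac_apply' i (MeasurableSet.of_discrete (s := {a | ¬ P a})),
      Set.indicator_apply]
  rw [hd]
  have := key i
  constructor
  · rintro (h | h) j hj
    · exact absurd ((by convert this.2 ⟨j, hj⟩)) h
    · exact h
  · intro h
    by_cases hp : P i
    · exact Or.inr hp
    · refine Or.inl fun h0 => ?_
      obtain ⟨j, hj⟩ := this.1 (by convert h0)
      exact hp (h j hj)

theorem rwAverage_congr (G : SimpleGraph V) {v w : V → ℝ} (h : v =ᵐ[rwMeasure G] w) :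
    rwAverage G v = rwAverage G w := by
  classical
  funext i
  unfold rwAverage
  congr 1
  refine Finset.sum_congr rfl fun j hj => ?_
  exact (ae_rwMeasure_iff G _).1 h j i ((G.mem_neighborFinset i j).1 hj).symm

theorem abs_rwAverage_le (G : SimpleGraph V) {v : V → ℝ} {C : ℝ} (hC : 0 ≤ C)
    (h : ∀ᵐ i ∂rwMeasure G, ‖v i‖ ≤ C) (i : V) : ‖rwAverage G v i‖ ≤ C := by
  classical
  have h1 : ‖∑ j ∈ G.neighborFinset i, v j‖ ≤ (G.degree i : ℝ) * C := by
    refine (norm_sum_le_of_le (f := v) (n := fun _ => C) _ fun j hj => ?_).trans ?_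
    · exact (ae_rwMeasure_iff G _).1 h j i ((G.mem_neighborFinset i j).1 hj).symm
    · simp
  have h2 : ‖rwAverage G v i‖ = (G.degree i : ℝ)⁻¹ * ‖∑ j ∈ G.neighborFinset i, v j‖ := by
    unfold rwAverage
    rw [norm_mul, norm_inv, Real.norm_natCast]
  rw [h2]
  rcases Nat.eq_zero_or_pos (G.degree i) with h0 | h0
  · simpa [h0] using hC
  · have h0' : (0 : ℝ) < G.degree i := by exact_mod_cast h0
    rw [inv_mul_le_iff₀ h0']
    exact h1

/-- The random walk operator `M(G)` on `(V, ν_G)`: `(vM(G))(i) = d(i)⁻¹ ∑_{(i,j) ∈ E(G)} v(j)`. -/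
noncomputable def rwOp (G : SimpleGraph V) : POp (rwMeasure G) :=
  LinearMap.mkContinuous
    { toFun := fun v => MemLp.toLp (rwAverage G v) MemLp.of_discrete
      map_add' := fun v w => by
        rw [← MemLp.toLp_add]
        congr 1
        rw [rwAverage_congr G (Lp.coeFn_add v w)]
        funext i
        simp [rwAverage, Finset.sum_add_distrib, mul_add]
      map_smul' := fun c v => by
        rw [RingHom.id_apply, ← MemLp.toLp_const_smul]
        congr 1
        rw [rwAverage_congr G (Lp.coeFn_smul c v)]
        funext i
        simp [rwAverage, ← Finset.mul_sum, mul_left_comm] }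
    (measureUnivNNReal (rwMeasure G) ^ (1 : ℝ≥0∞).toReal⁻¹ : NNReal)
    fun v => by
      refine Lp.norm_le_of_ae_bound (norm_nonneg v) ?_
      filter_upwards [MemLp.coeFn_toLp (μ := rwMeasure G) (p := 1) (f := rwAverage G v)
        MemLp.of_discrete] with i hi
      refine (congrArg norm hi).trans_le (abs_rwAverage_le G (norm_nonneg v) ?_ i)
      filter_upwards [ae_le_eLpNormEssSup (f := v) (μ := rwMeasure G)] with j hj
      rw [Lp.norm_def, eLpNorm_exponent_top, ← toReal_enorm]
      refine ENNReal.toReal_mono ?_ hj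
      rw [← eLpNorm_exponent_top]
      exact Lp.eLpNorm_ne_top v

theorem rwOp_apply (G : SimpleGraph V) (v : Lp ℝ ∞ (rwMeasure G)) :
    rwOp G v =ᵐ[rwMeasure G] rwAverage G v :=
  MemLp.coeFn_toLp MemLp.of_discrete

end Graphs

/-- The random walk operator `M(G)` of a finite graph `G` with at least one edge, as a P-operator on
`V` with the discrete σ-algebra and the stationary measure `ν_G`. -/
noncomputable def randomWalk {V : Type u} [Fintype V] (G : SimpleGraph V)
    (hG : G.edgeSet.Nonempty) : POperator.{u} :=
  letI : MeasurableSpace V := ⊤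
  haveI : DiscreteMeasurableSpace V := ⟨fun _ => trivial⟩
  haveI := rwMeasure_isProbability G hG
  { Ω := V, μ := rwMeasure G, op := rwOp G }

/-! Positivity gives |vA| ≤ |v|A, and self-adjointness with 1A = 1 gives E(vA) = E(v). So a Markov
graphop contracts the L¹ norm on L^∞ (`POp.IsMarkovGraphop.norm_apply_le`) and maps [-1,1]-valued
functions to such functions. Its profiles therefore consist of laws on the compact cube [-1,1]^{2k},
and joint laws depend on the functions continuously in L¹, with a modulus common to all Markov
graphops (`POp.dist_jointLaw_le`).

Being a Markov graphop is a closed condition on profiles. Self-adjointness equates two integrals of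
continuous functions against laws in the 2-profile. Positivity and 1-regularity follow from
inequalities between such integrals over the 1-profile, and these survive weak limits. Only
one-sided approximation is needed: every point of every profile of A must be a limit of points of
profiles of Markov graphops (`POp.IsMarkovLimit.isMarkovGraphop`).

The limit of a sequence A_n along an ultrafilter is built from a countable family of sequences of
[-1,1]-valued functions that contains 1 and is closed under products and under the operators. Their
joint laws live on one compact metrizable cube and converge to some ν. On the cube with measure ν,
the limit operator sends the coordinate of a sequence to the coordinate of its image. The L¹
contraction passes to the limit, so this rule is well defined and bounded on linear combinations of
coordinates. Closure under products and Stone–Weierstrass make these combinations dense in L¹(ν),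
and the operator extends.

Linear combinations, truncated to [-1,1], show that points of the limit profiles are limits of
points of the profiles of A_n, so the limit is Markov. For the reverse inclusion the family must be
rich enough: for each k it approximates every sequence of k-tuples up to any ε along the
ultrafilter, which a countable family can do because the limit laws form a separable set
(`exists_countable_families`). Hence d_M tends to 0 along the ultrafilter, and a subsequence
converges. Random walk operators are Markov graphops, so the statements on graphs follow. -/

set_option linter.unusedSectionVars false

/-! ### The inclusion of `L^∞` into `L^1` -/

section Inclusion

variable {Ω : Type u} [MeasurableSpace Ω] (μ : Measure Ω) [IsProbabilityMeasure μ]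

theorem memLp_one_of_Linfty (v : Lp ℝ ∞ μ) : MemLp v 1 μ :=
  (Lp.memLp v).mono_exponent le_top

/-- The inclusion `L^∞(Ω) → L^1(Ω)`. -/
noncomputable def inclL1 : Lp ℝ ∞ μ →L[ℝ] Lp ℝ 1 μ :=
  LinearMap.mkContinuous
    { toFun := fun v => (memLp_one_of_Linfty μ v).toLp v
      map_add' := fun v w => by
        rw [← MemLp.toLp_add]
        exact MemLp.toLp_congr _ _ (Lp.coeFn_add v w)
      map_smul' := fun c v => by
        rw [RingHom.id_apply, ← MemLp.toLp_const_smul]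
        exact MemLp.toLp_congr _ _ (Lp.coeFn_smul c v) }
    1
    fun v => by
      change ‖(memLp_one_of_Linfty μ v).toLp v‖ ≤ 1 * ‖v‖
      rw [one_mul, Lp.norm_toLp, Lp.norm_def]
      exact ENNReal.toReal_mono (Lp.eLpNorm_ne_top v)
        (eLpNorm_le_eLpNorm_of_exponent_le le_top (Lp.aestronglyMeasurable v))

variable {μ}

theorem coeFn_inclL1 (v : Lp ℝ ∞ μ) : inclL1 μ v =ᵐ[μ] v :=
  MemLp.coeFn_toLp (memLp_one_of_Linfty μ v)

theorem norm_inclL1 (v : Lp ℝ ∞ μ) : ‖inclL1 μ v‖ = ∫ x, |v x| ∂μ := by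
  rw [L1.norm_eq_integral_norm]
  refine integral_congr_ae ?_
  filter_upwards [coeFn_inclL1 v] with x hx
  rw [hx, Real.norm_eq_abs]

theorem norm_inclL1_sub (v w : Lp ℝ ∞ μ) : ‖inclL1 μ (v - w)‖ = ∫ x, |v x - w x| ∂μ := by
  rw [norm_inclL1]
  refine integral_congr_ae ?_
  filter_upwards [Lp.coeFn_sub v w] with x hx
  rw [hx, Pi.sub_apply]

theorem ae_abs_le_norm (v : Lp ℝ ∞ μ) : ∀ᵐ x ∂μ, |v x| ≤ ‖v‖ := by
  filter_upwards [ae_le_eLpNormEssSup (f := v) (μ := μ)] with j hj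
  rw [← Real.norm_eq_abs, Lp.norm_def, eLpNorm_exponent_top, ← toReal_enorm]
  refine ENNReal.toReal_mono ?_ hj
  rw [← eLpNorm_exponent_top]
  exact Lp.eLpNorm_ne_top v

theorem integrable_Linfty (v : Lp ℝ ∞ μ) : Integrable v μ :=
  memLp_one_iff_integrable.1 (memLp_one_of_Linfty μ v)

theorem integrable_L1 (v : Lp ℝ 1 μ) : Integrable v μ :=
  memLp_one_iff_integrable.1 (Lp.memLp v)

theorem coeFn_LpConst (p : ℝ≥0∞) (c : ℝ) : Lp.const p μ c =ᵐ[μ] fun _ => c :=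
  Lp.coeFn_const p μ c

end Inclusion

/-! ### Elementary properties of Markov graphops -/

section Markov

variable {Ω : Type u} [MeasurableSpace Ω] {μ : Measure Ω} [IsProbabilityMeasure μ]

/-- Self-adjointness against the constant 1, followed by 1A = 1. -/
theorem POp.IsMarkovGraphop.integral_apply {A : POp μ} (hA : A.IsMarkovGraphop) (v : Lp ℝ ∞ μ) :
    ∫ x, A v x ∂μ = ∫ x, v x ∂μ := by
  have h := hA.selfAdjoint v (Lp.const ∞ μ 1)
  unfold POp.form at h
  have h1 : ∫ x, A v x * Lp.const ∞ μ (1 : ℝ) x ∂μ = ∫ x, A v x ∂μ := by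
    refine integral_congr_ae ?_
    filter_upwards [coeFn_LpConst (μ := μ) ∞ 1] with x hx
    rw [hx, mul_one]
  have h2 : ∫ x, A (Lp.const ∞ μ 1) x * v x ∂μ = ∫ x, v x ∂μ := by
    rw [show A (Lp.const ∞ μ 1) = Lp.const 1 μ 1 from hA.regular]
    refine integral_congr_ae ?_
    filter_upwards [coeFn_LpConst (μ := μ) 1 1] with x hx
    rw [hx, one_mul]
  rw [← h1, h, h2]

theorem POp.IsPositivityPreserving.mono {A : POp μ} (hA : A.IsPositivityPreserving)
    {v w : Lp ℝ ∞ μ} (h : ∀ᵐ x ∂μ, v x ≤ w x) : ∀ᵐ x ∂μ, A v x ≤ A w x := by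
  have h1 : ∀ᵐ x ∂μ, 0 ≤ (w - v : Lp ℝ ∞ μ) x := by
    filter_upwards [h, Lp.coeFn_sub w v] with x hx hx'
    rw [hx']
    exact sub_nonneg.2 hx
  filter_upwards [hA _ h1, Lp.coeFn_sub (A w) (A v)] with x hx hx'
  rw [map_sub, hx'] at hx
  exact sub_nonneg.1 hx

theorem POp.IsPositivityPreserving.abs_apply_le {A : POp μ} (hA : A.IsPositivityPreserving)
    {v w : Lp ℝ ∞ μ} (h : ∀ᵐ x ∂μ, |v x| ≤ w x) : ∀ᵐ x ∂μ, |A v x| ≤ A w x := by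
  have h1 : ∀ᵐ x ∂μ, A v x ≤ A w x := hA.mono (h.mono fun x hx => (abs_le.1 hx).2)
  have h2 : ∀ᵐ x ∂μ, A (-v) x ≤ A w x := by
    refine hA.mono ?_
    filter_upwards [h, Lp.coeFn_neg v] with x hx hx'
    rw [hx', Pi.neg_apply]
    linarith [(abs_le.1 hx).1]
  filter_upwards [h1, h2, Lp.coeFn_neg (A v)] with x hx1 hx2 hx3
  rw [map_neg, hx3, Pi.neg_apply] at hx2
  exact abs_le.2 ⟨by linarith, hx1⟩

theorem POp.IsMarkovGraphop.abs_apply_le_one {A : POp μ} (hA : A.IsMarkovGraphop)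
    {v : Lp ℝ ∞ μ} (h : ∀ᵐ x ∂μ, |v x| ≤ 1) : ∀ᵐ x ∂μ, |A v x| ≤ 1 := by
  have h1 : ∀ᵐ x ∂μ, |A v x| ≤ A (Lp.const ∞ μ 1) x := by
    refine hA.positivityPreserving.abs_apply_le ?_
    filter_upwards [h, coeFn_LpConst (μ := μ) ∞ 1] with x hx hx'
    rwa [hx']
  rw [show A (Lp.const ∞ μ 1) = Lp.const 1 μ 1 from hA.regular] at h1
  filter_upwards [h1, coeFn_LpConst (μ := μ) 1 1] with x hx hx'
  rwa [hx'] at hx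

/-- Integrate |vA| ≤ |v|A and use that A preserves integrals. All later continuity and extension
arguments rest on this L¹ bound. -/
theorem POp.IsMarkovGraphop.norm_apply_le {A : POp μ} (hA : A.IsMarkovGraphop) (v : Lp ℝ ∞ μ) :
    ‖A v‖ ≤ ‖inclL1 μ v‖ := by
  have hv : MemLp (fun x => |v x|) ∞ μ := (Lp.memLp v).abs
  have h1 : ∀ᵐ x ∂μ, |A v x| ≤ A (hv.toLp _) x := by
    refine hA.positivityPreserving.abs_apply_le ?_
    filter_upwards [hv.coeFn_toLp] with x hx
    rw [hx]
  rw [norm_inclL1, L1.norm_eq_integral_norm, ← integral_congr_ae hv.coeFn_toLp,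
    ← hA.integral_apply]
  exact integral_mono_ae (integrable_L1 _).norm (integrable_L1 _) h1

end Markov

/-! ### Lévy–Prokhorov distance of joint laws -/

/-- Both variables live on one space: outside an event of probability at most δ they are δ-close, so
one lands in the thickening of any set that contains the other. -/
theorem levyProkhorovDist_map_le {Ω : Type*} [MeasurableSpace Ω] {μ : Measure Ω}
    [IsProbabilityMeasure μ] {E : Type*} [PseudoMetricSpace E] [MeasurableSpace E]
    [OpensMeasurableSpace E] {Y Z : Ω → E} (hY : AEMeasurable Y μ) (hZ : AEMeasurable Z μ)
    {δ : ℝ} (hδ : 0 ≤ δ) (h : μ {x | δ < dist (Y x) (Z x)} ≤ ENNReal.ofReal δ) :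
    levyProkhorovDist (μ.map Y) (μ.map Z) ≤ δ := by
  have := Measure.isProbabilityMeasure_map hY
  have := Measure.isProbabilityMeasure_map hZ
  refine levyProkhorovDist_le_of_forall_le _ _ hδ fun ε B hε hB => ?_
  rw [Measure.map_apply_of_aemeasurable hY hB,
    Measure.map_apply_of_aemeasurable hZ Metric.isOpen_thickening.measurableSet]
  calc μ (Y ⁻¹' B) ≤ μ (Z ⁻¹' Metric.thickening ε B ∪ {x | δ < dist (Y x) (Z x)}) := by
        refine measure_mono fun x hx => ?_
        by_cases hd : δ < dist (Y x) (Z x)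
        · exact Or.inr hd
        · refine Or.inl (Metric.mem_thickening_iff.2 ⟨Y x, hx, ?_⟩)
          rw [dist_comm]
          exact (not_lt.1 hd).trans_lt hε
    _ ≤ _ := (measure_union_le _ _).trans
        (add_le_add le_rfl (h.trans (ENNReal.ofReal_le_ofReal hε.le)))

theorem EuclideanSpace.norm_le_sum_abs {ι : Type*} [Fintype ι] (x : EuclideanSpace ℝ ι) :
    ‖x‖ ≤ ∑ i, |x i| := by
  rw [EuclideanSpace.norm_eq]
  refine Real.sqrt_le_iff.2 ⟨Finset.sum_nonneg fun i _ => abs_nonneg _, ?_⟩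
  simpa using Finset.sum_sq_le_sq_sum_of_nonneg (s := Finset.univ) (f := fun i => |x i|)
    fun i _ => abs_nonneg _

section JointLaw

variable {Ω : Type u} [MeasurableSpace Ω] {μ : Measure Ω} [IsProbabilityMeasure μ]

/-- The random vector `(v_1, …, v_k, v_1 A, …, v_k A)`. -/
noncomputable def POp.jointVec (A : POp μ) {k : ℕ} (v : Fin k → Lp ℝ ∞ μ) (x : Ω) :
    Fin k ⊕ Fin k → ℝ :=
  Sum.elim (fun i => v i x) (fun i => A (v i) x)

theorem POp.aemeasurable_jointVec (A : POp μ) {k : ℕ} (v : Fin k → Lp ℝ ∞ μ) :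
    AEMeasurable (A.jointVec v) μ := by
  refine aemeasurable_pi_lambda _ fun i => ?_
  cases i with
  | inl i => exact (Lp.aestronglyMeasurable (v i)).aemeasurable
  | inr i => exact (Lp.aestronglyMeasurable (A (v i))).aemeasurable

theorem POp.aemeasurable_toLp_jointVec (A : POp μ) {k : ℕ} (v : Fin k → Lp ℝ ∞ μ) :
    AEMeasurable (fun x => WithLp.toLp 2 (A.jointVec v x)) μ :=
  (WithLp.measurable_toLp 2 _).comp_aemeasurable (A.aemeasurable_jointVec v)

theorem POp.toMeasure_jointLaw (A : POp μ) {k : ℕ} (v : Fin k → Lp ℝ ∞ μ) :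
    (A.jointLaw v : Measure (EuclideanSpace ℝ (Fin k ⊕ Fin k))) =
      μ.map fun x => WithLp.toLp 2 (A.jointVec v x) := rfl

theorem POp.dist_jointLaw_le (A : POp μ) (hA : ∀ v, ‖A v‖ ≤ ‖inclL1 μ v‖) {k : ℕ}
    (v w : Fin k → Lp ℝ ∞ μ) {δ : ℝ} (hδ : 0 < δ)
    (h : ∑ i, ‖inclL1 μ (v i - w i)‖ ≤ δ ^ 2 / 2) :
    dist (LevyProkhorov.ofMeasure (A.jointLaw v)) (LevyProkhorov.ofMeasure (A.jointLaw w)) ≤ δ := by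
  rw [LevyProkhorov.dist_probabilityMeasure_def]
  refine levyProkhorovDist_map_le (A.aemeasurable_toLp_jointVec v)
    (A.aemeasurable_toLp_jointVec w) hδ.le ?_
  let g : Ω → ℝ := fun x => ∑ i, (|v i x - w i x| + |A (v i) x - A (w i) x|)
  have hint : ∀ i, Integrable (fun x => |v i x - w i x|) μ := fun i =>
    ((integrable_Linfty _).sub (integrable_Linfty _)).abs
  have hint' : ∀ i, Integrable (fun x => |A (v i) x - A (w i) x|) μ := fun i =>
    ((integrable_L1 _).sub (integrable_L1 _)).abs
  have hg : Integrable g μ := integrable_finsetSum _ fun i _ => (hint i).add (hint' i)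
  have hg0 : ∀ x, 0 ≤ g x := fun x => Finset.sum_nonneg fun i _ => by positivity
  have hgi : ∫ x, g x ∂μ ≤ δ ^ 2 := by
    have : ∫ x, g x ∂μ = ∑ i, (‖inclL1 μ (v i - w i)‖ + ‖A (v i - w i)‖) := by
      refine (integral_finsetSum _ fun i _ => (hint i).add (hint' i)).trans ?_
      refine Finset.sum_congr rfl fun i _ => ?_
      refine (integral_add (hint i) (hint' i)).trans ?_
      rw [norm_inclL1_sub, map_sub, L1.norm_eq_integral_norm]
      congr 1
      refine integral_congr_ae ?_
      filter_upwards [Lp.coeFn_sub (A (v i)) (A (w i))] with x hx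
      rw [hx, Pi.sub_apply, Real.norm_eq_abs]
    rw [this, Finset.sum_add_distrib]
    have := Finset.sum_le_sum fun i (_ : i ∈ Finset.univ) => hA (v i - w i)
    linarith
  have hdist : ∀ x, dist (WithLp.toLp 2 (A.jointVec v x)) (WithLp.toLp 2 (A.jointVec w x)) ≤ g x := by
    intro x
    rw [dist_eq_norm]
    refine (EuclideanSpace.norm_le_sum_abs _).trans_eq ?_
    rw [Fintype.sum_sum_type, ← Finset.sum_add_distrib]
    rfl
  -- Markov's inequality at level δ. The bound δ²/2 in the hypothesis is used twice, for v - w and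
  -- for its image, which gives E(g) ≤ δ² and so probability at most δ.
  have hM := mul_meas_ge_le_integral_of_nonneg (μ := μ) (Eventually.of_forall hg0) hg δ
  have hM' : μ.real {x | δ ≤ g x} ≤ δ := by
    have : δ * μ.real {x | δ ≤ g x} ≤ δ * δ := by nlinarith
    exact le_of_mul_le_mul_left this hδ
  refine (measure_mono (t := {x | δ ≤ g x}) fun x hx => ?_).trans ?_
  · simp only [Set.mem_ofPred_eq] at hx ⊢
    exact hx.le.trans (hdist x)
  rw [← ofReal_measureReal (measure_ne_top μ _)]
  exact ENNReal.ofReal_le_ofReal hM'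

end JointLaw

/-! ### Laws supported on the cube -/

section Cube

/-- The cube `[-1, 1]^ι`. -/
abbrev Cube (ι : Type*) : Type _ := ι → Set.Icc (-1 : ℝ) 1

/-- The retraction of `ℝ` onto `[-1, 1]`. -/
noncomputable def clip : ℝ → Set.Icc (-1 : ℝ) 1 := Set.projIcc (-1) 1 (by norm_num)

theorem continuous_clip : Continuous clip := continuous_projIcc

theorem coe_clip {x : ℝ} (hx : |x| ≤ 1) : (clip x : ℝ) = x := by
  rw [clip, Set.projIcc_of_mem _ (abs_le.1 hx)]

/-- The truncation is a nearest point of [-1,1], so truncating an approximation costs no more than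
its distance to a function with values in [-1,1]. -/
theorem abs_clip_sub_le (x : ℝ) {y : ℝ} (hy : |y| ≤ 1) : |(clip x : ℝ) - x| ≤ |y - x| := by
  obtain ⟨h1, h2⟩ := abs_le.1 hy
  rw [clip, Set.coe_projIcc]
  rcases le_total x (-1) with h | h
  · rw [min_eq_right (by linarith), max_eq_left h, abs_of_nonneg (by linarith),
      abs_of_nonneg (by linarith)]
    linarith
  · rcases le_total x 1 with h' | h'
    · rw [min_eq_right h', max_eq_right h]
      simp
    · rw [min_eq_left h', max_eq_right (by norm_num), abs_of_nonpos (by linarith),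
        abs_of_nonpos (by linarith)]
      linarith

/-- The inclusion of the cube into Euclidean space. -/
def cubeIncl (ι : Type*) (x : Cube ι) : EuclideanSpace ℝ ι := WithLp.toLp 2 fun i => (x i : ℝ)

theorem continuous_cubeIncl (ι : Type*) [Fintype ι] : Continuous (cubeIncl ι) :=
  (PiLp.continuous_toLp 2 _).comp
    (continuous_pi fun i => continuous_subtype_val.comp (continuous_apply i))

/-- The law on Euclidean space of a random point of the cube. -/
noncomputable def cubeLaw {ι : Type*} [Fintype ι] (ρ : ProbabilityMeasure (Cube ι)) :
    LevyProkhorov (ProbabilityMeasure (EuclideanSpace ℝ ι)) :=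
  LevyProkhorov.ofMeasure (ρ.map (continuous_cubeIncl ι).measurable.aemeasurable)

theorem continuous_cubeLaw {ι : Type*} [Fintype ι] : Continuous (cubeLaw (ι := ι)) :=
  LevyProkhorov.probabilityMeasureHomeomorph.continuous.comp
    (ProbabilityMeasure.continuous_map (continuous_cubeIncl ι))

theorem isCompact_range_cubeLaw {ι : Type*} [Fintype ι] :
    IsCompact (Set.range (cubeLaw (ι := ι))) :=
  isCompact_range continuous_cubeLaw

variable {Ω : Type u} [MeasurableSpace Ω] {μ : Measure Ω} [IsProbabilityMeasure μ]

theorem POp.jointLaw_mem_range_cubeLaw (A : POp μ) {k : ℕ} {v : Fin k → Lp ℝ ∞ μ}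
    (h : ∀ i, ∀ᵐ x ∂μ, |A.jointVec v x i| ≤ 1) :
    LevyProkhorov.ofMeasure (A.jointLaw v) ∈ Set.range (cubeLaw (ι := Fin k ⊕ Fin k)) := by
  have hm : AEMeasurable (fun x i => clip (A.jointVec v x i)) μ :=
    aemeasurable_pi_lambda _ fun i => continuous_clip.measurable.comp_aemeasurable
      ((aemeasurable_pi_iff.1 (A.aemeasurable_jointVec v)) i)
  let ρ : ProbabilityMeasure (Cube (Fin k ⊕ Fin k)) :=
    ⟨μ.map fun x i => clip (A.jointVec v x i), Measure.isProbabilityMeasure_map hm⟩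
  have hρ : (ρ : Measure (Cube (Fin k ⊕ Fin k))) = μ.map fun x i => clip (A.jointVec v x i) := rfl
  refine ⟨ρ, ?_⟩
  unfold cubeLaw
  congr 1
  apply ProbabilityMeasure.toMeasure_injective
  rw [ProbabilityMeasure.toMeasure_map, hρ, A.toMeasure_jointLaw,
    AEMeasurable.map_map_of_aemeasurable (continuous_cubeIncl _).measurable.aemeasurable hm]
  refine Measure.map_congr ?_
  filter_upwards [ae_all_iff.2 h] with x hx
  simp only [Function.comp_apply, cubeIncl]
  congr 1
  funext i
  exact coe_clip (hx i)

theorem POp.IsMarkovGraphop.abs_jointVec_le {A : POp μ} (hA : A.IsMarkovGraphop) {k : ℕ}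
    {v : Fin k → Lp ℝ ∞ μ} (hv : ∀ i, ∀ᵐ x ∂μ, v i x ∈ Set.Icc (-1 : ℝ) 1) (i : Fin k ⊕ Fin k) :
    ∀ᵐ x ∂μ, |A.jointVec v x i| ≤ 1 := by
  have hv' : ∀ i, ∀ᵐ x ∂μ, |v i x| ≤ 1 := fun i => (hv i).mono fun x hx => abs_le.2 hx
  cases i with
  | inl i => exact hv' i
  | inr i => exact hA.abs_apply_le_one (hv' i)

theorem POp.IsMarkovGraphop.profile_subset {A : POp μ} (hA : A.IsMarkovGraphop) (k : ℕ) :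
    A.profile k ⊆ Set.range (cubeLaw (ι := Fin k ⊕ Fin k)) := by
  rintro ρ ⟨v, hv, rfl⟩
  exact A.jointLaw_mem_range_cubeLaw (hA.abs_jointVec_le hv)

end Cube

/-! ### Limits of Markov graphops are Markov graphops -/

section Closed

variable {Ω : Type u} [MeasurableSpace Ω] {μ : Measure Ω} [IsProbabilityMeasure μ]

/-- The almost sure bound is a property of the law alone. It matters for operators not yet known to
be Markov, whose values are a priori only integrable. -/
theorem POp.abs_jointVec_le_of_mem_range_cubeLaw (A : POp μ) {k : ℕ} {v : Fin k → Lp ℝ ∞ μ}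
    (h : LevyProkhorov.ofMeasure (A.jointLaw v) ∈ Set.range (cubeLaw (ι := Fin k ⊕ Fin k)))
    (i : Fin k ⊕ Fin k) : ∀ᵐ x ∂μ, |A.jointVec v x i| ≤ 1 := by
  obtain ⟨ρ, hρ⟩ := h
  have hρ' : (ρ : Measure (Cube (Fin k ⊕ Fin k))).map (cubeIncl _) =
      μ.map fun x => WithLp.toLp 2 (A.jointVec v x) := by
    rw [← A.toMeasure_jointLaw]
    exact congrArg (fun σ : LevyProkhorov (ProbabilityMeasure _) =>
      (σ.toMeasure : Measure (EuclideanSpace ℝ (Fin k ⊕ Fin k)))) hρ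
  have hcl : MeasurableSet {x : EuclideanSpace ℝ (Fin k ⊕ Fin k) | |x i| ≤ 1} :=
    (isClosed_le (by fun_prop) continuous_const).measurableSet
  have h1 : ∀ᵐ x ∂(ρ : Measure (Cube (Fin k ⊕ Fin k))).map (cubeIncl _), |x i| ≤ 1 := by
    rw [ae_map_iff (continuous_cubeIncl _).measurable.aemeasurable hcl]
    exact Eventually.of_forall fun x => abs_le.2 (x i).2
  rw [hρ', ae_map_iff (A.aemeasurable_toLp_jointVec v) hcl] at h1
  exact h1

/-- Weak convergence only tests bounded functions, while the φ of interest are products and absolute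
values. Precomposition with `clip` makes φ bounded without changing the integral. -/
theorem POp.integral_jointLaw (A : POp μ) {k : ℕ} {v : Fin k → Lp ℝ ∞ μ}
    (h : ∀ i, ∀ᵐ x ∂μ, |A.jointVec v x i| ≤ 1) {φ : (Fin k ⊕ Fin k → ℝ) → ℝ} (hφ : Continuous φ) :
    ∫ y, φ (fun i => clip (y i)) ∂(A.jointLaw v : Measure (EuclideanSpace ℝ (Fin k ⊕ Fin k))) =
      ∫ x, φ (A.jointVec v x) ∂μ := by
  rw [A.toMeasure_jointLaw, integral_map (A.aemeasurable_toLp_jointVec v)]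
  · refine integral_congr_ae ?_
    filter_upwards [ae_all_iff.2 h] with x hx
    congr 1
    funext i
    exact coe_clip (hx i)
  · refine Continuous.aestronglyMeasurable (hφ.comp (continuous_pi fun i => ?_))
    exact continuous_subtype_val.comp (continuous_clip.comp (by fun_prop))

theorem tendsto_integral_of_tendsto_jointLaw {J : Type*} {F : Filter J} {B : J → POperator.{u}}
    {k : ℕ} {w : ∀ j, Fin k → Lp ℝ ∞ (B j).μ} (A : POp μ) {v : Fin k → Lp ℝ ∞ μ}
    (hw : ∀ j i, ∀ᵐ x ∂(B j).μ, |(B j).op.jointVec (w j) x i| ≤ 1)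
    (hv : ∀ i, ∀ᵐ x ∂μ, |A.jointVec v x i| ≤ 1)
    (h : Tendsto (fun j => LevyProkhorov.ofMeasure ((B j).op.jointLaw (w j))) F
      (𝓝 (LevyProkhorov.ofMeasure (A.jointLaw v))))
    {φ : (Fin k ⊕ Fin k → ℝ) → ℝ} (hφ : Continuous φ) :
    Tendsto (fun j => ∫ x, φ ((B j).op.jointVec (w j) x) ∂(B j).μ) F
      (𝓝 (∫ x, φ (A.jointVec v x) ∂μ)) := by
  have h' : Tendsto (fun j => (B j).op.jointLaw (w j)) F (𝓝 (A.jointLaw v)) :=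
    (LevyProkhorov.continuous_toMeasure_probabilityMeasure.tendsto _).comp h
  rw [ProbabilityMeasure.tendsto_iff_forall_integral_tendsto] at h'
  let ψ : BoundedContinuousFunction (Cube (Fin k ⊕ Fin k)) ℝ :=
    BoundedContinuousFunction.mkOfCompact ⟨fun y => φ fun i => (y i : ℝ), hφ.comp
      (continuous_pi fun i => continuous_subtype_val.comp (continuous_apply i))⟩
  have h2 := h' (ψ.compContinuous ⟨fun y i => clip (y i),
    continuous_pi fun i => continuous_clip.comp (by fun_prop)⟩)
  have e1 := A.integral_jointLaw hv hφ
  have e2 := fun j => (B j).op.integral_jointLaw (hw j) hφ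
  simp only [← e1, ← e2]
  exact h2

/-- Points of the profiles of `A` are limits of points of profiles of Markov graphops. -/
def POp.IsMarkovLimit (A : POp μ) : Prop :=
  ∀ k, ∀ ρ ∈ A.profile k, ∀ ε > 0,
    ∃ B : POperator.{u}, B.IsMarkovGraphop ∧ ∃ σ ∈ B.profile k, dist σ ρ < ε

theorem POp.IsMarkovLimit.exists_seq {A : POp μ} (hA : A.IsMarkovLimit) {k : ℕ}
    {v : Fin k → Lp ℝ ∞ μ} (hv : ∀ i, ∀ᵐ x ∂μ, v i x ∈ Set.Icc (-1 : ℝ) 1) :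
    (∀ i, ∀ᵐ x ∂μ, |A.jointVec v x i| ≤ 1) ∧
    ∃ (B : ℕ → POperator.{u}) (w : ∀ n, Fin k → Lp ℝ ∞ (B n).μ),
      (∀ n, (B n).op.IsMarkovGraphop) ∧
      ∀ φ : (Fin k ⊕ Fin k → ℝ) → ℝ, Continuous φ →
        Tendsto (fun n => ∫ x, φ ((B n).op.jointVec (w n) x) ∂(B n).μ) atTop
          (𝓝 (∫ x, φ (A.jointVec v x) ∂μ)) := by
  have h := fun n : ℕ => hA k _ ⟨v, hv, rfl⟩ (1 / ((n : ℝ) + 1)) Nat.one_div_pos_of_nat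
  choose B hB σ hσ hd using h
  choose w hw hwσ using hσ
  have hlim : Tendsto σ atTop (𝓝 (LevyProkhorov.ofMeasure (A.jointLaw v))) := by
    rw [tendsto_iff_dist_tendsto_zero]
    exact squeeze_zero (fun n => dist_nonneg) (fun n => (hd n).le)
      tendsto_one_div_add_atTop_nhds_zero_nat
  have hv1 : ∀ i, ∀ᵐ x ∂μ, |A.jointVec v x i| ≤ 1 := by
    refine A.abs_jointVec_le_of_mem_range_cubeLaw ?_
    -- The laws carried by the cube form a compact, hence closed, set, so the bound by 1 passes to
    -- the limit.
    refine (isCompact_range_cubeLaw (ι := Fin k ⊕ Fin k)).isClosed.mem_of_tendsto hlim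
      (Eventually.of_forall fun n => ?_)
    exact (hB n).profile_subset k ⟨w n, hw n, hwσ n⟩
  refine ⟨hv1, B, w, hB, fun φ hφ => ?_⟩
  obtain rfl : σ = fun n => LevyProkhorov.ofMeasure ((B n).op.jointLaw (w n)) := funext hwσ
  exact tendsto_integral_of_tendsto_jointLaw A (fun n => (hB n).abs_jointVec_le (hw n)) hv1 hlim hφ

theorem POp.form_smul_smul (A : POp μ) (c d : ℝ) (v w : Lp ℝ ∞ μ) :
    A.form (c • v) (d • w) = c * d * A.form v w := by
  unfold POp.form
  rw [← integral_const_mul, map_smul]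
  refine integral_congr_ae ?_
  filter_upwards [Lp.coeFn_smul c (A v), Lp.coeFn_smul d w] with x hx hx'
  rw [hx, hx', Pi.smul_apply, Pi.smul_apply, smul_eq_mul, smul_eq_mul]
  ring

theorem exists_smul_unit (v : Lp ℝ ∞ μ) :
    ∃ c : ℝ, 0 < c ∧ ∃ v' : Lp ℝ ∞ μ, v = c • v' ∧ ∀ᵐ x ∂μ, v' x ∈ Set.Icc (-1 : ℝ) 1 := by
  have hc : 0 < ‖v‖ + 1 := by positivity
  refine ⟨‖v‖ + 1, hc, (‖v‖ + 1)⁻¹ • v, by rw [smul_inv_smul₀ hc.ne'], ?_⟩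
  filter_upwards [ae_abs_le_norm v, Lp.coeFn_smul (‖v‖ + 1)⁻¹ v] with x hx hx'
  refine abs_le.1 ?_
  rw [hx', Pi.smul_apply, smul_eq_mul, abs_mul, abs_of_pos (inv_pos.2 hc), inv_mul_le_iff₀ hc]
  linarith

/-- After scaling, both forms are integrals of coordinate products against one law in the 2-profile,
and they agree along the approximating Markov graphops. -/
theorem POp.IsMarkovLimit.isSelfAdjoint {A : POp μ} (hA : A.IsMarkovLimit) :
    A.IsSelfAdjoint := by
  intro v w
  obtain ⟨c, -, v, rfl, hv⟩ := exists_smul_unit v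
  obtain ⟨d, -, w, rfl, hw⟩ := exists_smul_unit w
  rw [A.form_smul_smul, A.form_smul_smul, mul_comm d c]
  congr 1
  obtain ⟨-, B, f, hB, hlim⟩ := hA.exists_seq (v := ![v, w]) (by
    intro i
    fin_cases i
    · exact hv
    · exact hw)
  have h1 := hlim (fun y => y (Sum.inr 0) * y (Sum.inl 1)) (by fun_prop)
  have h2 := hlim (fun y => y (Sum.inr 1) * y (Sum.inl 0)) (by fun_prop)
  refine tendsto_nhds_unique h1 (h2.congr fun n => ?_)
  exact (hB n).selfAdjoint (f n 1) (f n 0)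

/-- If `∫ g(w) → 0` implies `∫ h(w B) → 0` along Markov graphops, then `g(v) = 0` implies
`h(v A) = 0`. -/
theorem POp.IsMarkovLimit.ae_eq_zero {A : POp μ} (hA : A.IsMarkovLimit) {g h : ℝ → ℝ}
    (hg : Continuous g) (hh : Continuous h) (hh0 : ∀ y, 0 ≤ h y)
    (hgh : ∀ B : POperator.{u}, B.IsMarkovGraphop → ∀ w : Lp ℝ ∞ B.μ,
      ∫ x, h (B.op w x) ∂B.μ ≤ ∫ x, g (w x) ∂B.μ)
    {v : Lp ℝ ∞ μ} (hv : ∀ᵐ x ∂μ, v x ∈ Set.Icc (-1 : ℝ) 1) (hgv : ∀ᵐ x ∂μ, g (v x) = 0) :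
    ∀ᵐ x ∂μ, h (A v x) = 0 := by
  obtain ⟨hv1, B, f, hB, hlim⟩ := hA.exists_seq (k := 1) (v := fun _ => v) fun _ => hv
  have h1 := hlim (fun y => g (y (Sum.inl 0))) (by fun_prop)
  have h2 := hlim (fun y => h (y (Sum.inr 0))) (by fun_prop)
  have h3 : ∫ x, h (A v x) ∂μ ≤ ∫ x, g (v x) ∂μ :=
    le_of_tendsto_of_tendsto' h2 h1 fun n => hgh (B n) (hB n) (f n 0)
  rw [integral_eq_zero_of_ae hgv] at h3
  have hAv : ∀ᵐ x ∂μ, |A v x| ≤ 1 := hv1 (Sum.inr 0)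
  obtain ⟨C, hC⟩ := (isCompact_Icc (a := (-1 : ℝ)) (b := 1)).exists_bound_of_continuousOn
    hh.continuousOn
  have hint : Integrable (fun x => h (A v x)) μ := by
    refine Integrable.of_bound (hh.comp_aestronglyMeasurable (Lp.aestronglyMeasurable _)) C ?_
    exact hAv.mono fun x hx => hC _ (abs_le.1 hx)
  have h4 : ∫ x, h (A v x) ∂μ = 0 := le_antisymm h3 (integral_nonneg fun x => hh0 _)
  exact (integral_eq_zero_iff_of_nonneg (fun x => hh0 _) hint).1 h4

/-- The L¹ norm does not increase and the integral is preserved. Since |y| - y is twice the negative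
part, this is positivity in a form stable under weak limits. -/
theorem POp.IsMarkovGraphop.integral_neg_part_le {A : POp μ} (hA : A.IsMarkovGraphop)
    (v : Lp ℝ ∞ μ) : ∫ x, (|A v x| - A v x) ∂μ ≤ ∫ x, (|v x| - v x) ∂μ := by
  rw [integral_sub (integrable_L1 _).abs (integrable_L1 _),
    integral_sub (integrable_Linfty _).abs (integrable_Linfty _), hA.integral_apply]
  have := hA.norm_apply_le v
  rw [norm_inclL1, L1.norm_eq_integral_norm] at this
  exact sub_le_sub_right this _

/-- The L¹ contraction applied to v - 1, whose image is vA - 1. This is 1-regularity in a form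
stable under weak limits. -/
theorem POp.IsMarkovGraphop.integral_abs_sub_one_le {A : POp μ} (hA : A.IsMarkovGraphop)
    (v : Lp ℝ ∞ μ) : ∫ x, |A v x - 1| ∂μ ≤ ∫ x, |v x - 1| ∂μ := by
  have := hA.norm_apply_le (v - Lp.const ∞ μ 1)
  rw [norm_inclL1_sub, L1.norm_eq_integral_norm, map_sub,
    show A (Lp.const ∞ μ 1) = Lp.const 1 μ 1 from hA.regular] at this
  convert this using 1
  · refine integral_congr_ae ?_
    filter_upwards [Lp.coeFn_sub (A v) (Lp.const 1 μ 1), coeFn_LpConst (μ := μ) 1 1] with x h1 h2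
    rw [h1, Pi.sub_apply, h2, Real.norm_eq_abs]
  · refine integral_congr_ae ?_
    filter_upwards [coeFn_LpConst (μ := μ) ∞ 1] with x h2
    rw [h2]

theorem POp.IsMarkovLimit.isMarkovGraphop {A : POp μ} (hA : A.IsMarkovLimit) :
    A.IsMarkovGraphop where
  selfAdjoint := hA.isSelfAdjoint
  positivityPreserving := by
    intro v hv
    obtain ⟨c, hc, w, rfl, hw⟩ := exists_smul_unit v
    have hw0 : ∀ᵐ x ∂μ, |w x| - w x = 0 := by
      filter_upwards [hv, Lp.coeFn_smul c w] with x hx hx'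
      rw [hx', Pi.smul_apply, smul_eq_mul] at hx
      rw [abs_of_nonneg (nonneg_of_mul_nonneg_right hx hc), sub_self]
    have h := hA.ae_eq_zero (g := fun y => |y| - y) (h := fun y => |y| - y) (by fun_prop)
      (by fun_prop) (fun y => sub_nonneg.2 (le_abs_self y))
      (fun B hB w => POp.IsMarkovGraphop.integral_neg_part_le hB w) hw hw0
    filter_upwards [h, Lp.coeFn_smul c (A w)] with x hx hx'
    rw [map_smul, hx', Pi.smul_apply, smul_eq_mul]
    exact mul_nonneg hc.le (sub_eq_zero.1 hx ▸ abs_nonneg _)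
  regular := by
    have h1 := coeFn_LpConst (μ := μ) ∞ 1
    have h := hA.ae_eq_zero (g := fun y => |y - 1|) (h := fun y => |y - 1|) (by fun_prop)
      (by fun_prop) (fun y => abs_nonneg _)
      (fun B hB w => POp.IsMarkovGraphop.integral_abs_sub_one_le hB w) (v := Lp.const ∞ μ 1)
      (by
        filter_upwards [h1] with x hx
        rw [hx]
        norm_num)
      (by
        filter_upwards [h1] with x hx
        rw [hx]
        simp)
    refine Lp.ext ?_
    filter_upwards [h, coeFn_LpConst (μ := μ) 1 1] with x hx hx'
    rw [hx']
    exact sub_eq_zero.1 (abs_eq_zero.1 hx)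

end Closed

/-! ### Measurable functions with values in `[-1, 1]` -/

section UnitFun

variable {Ω : Type u} [MeasurableSpace Ω]

/-- Measurable functions with values in `[-1, 1]`. -/
abbrev UnitFun (Ω : Type u) [MeasurableSpace Ω] : Type u :=
  {f : Ω → Set.Icc (-1 : ℝ) 1 // Measurable f}

theorem memLp_coe_clip_comp (p : ℝ≥0∞) (μ : Measure Ω) [IsProbabilityMeasure μ]
    {f : Ω → Set.Icc (-1 : ℝ) 1} (hf : AEMeasurable f μ) : MemLp (fun x => (f x : ℝ)) p μ :=
  MemLp.of_bound (measurable_subtype_coe.comp_aemeasurable hf).aestronglyMeasurable 1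
    (Eventually.of_forall fun x => abs_le.2 (f x).2)

variable (μ : Measure Ω) [IsProbabilityMeasure μ]

/-- The class in `L^∞` of a measurable function with values in `[-1, 1]`. -/
noncomputable def UnitFun.toLinf (f : UnitFun Ω) : Lp ℝ ∞ μ :=
  (memLp_coe_clip_comp ∞ μ f.2.aemeasurable).toLp _

theorem UnitFun.coeFn_toLinf (f : UnitFun Ω) : f.toLinf μ =ᵐ[μ] fun x => (f.1 x : ℝ) :=
  MemLp.coeFn_toLp _

theorem UnitFun.toLinf_mem_Icc (f : UnitFun Ω) : ∀ᵐ x ∂μ, f.toLinf μ x ∈ Set.Icc (-1 : ℝ) 1 := by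
  filter_upwards [f.coeFn_toLinf μ] with x hx
  rw [hx]
  exact (f.1 x).2

theorem exists_unitFun {g : Ω → ℝ} (hg : AEStronglyMeasurable g μ) (h : ∀ᵐ x ∂μ, |g x| ≤ 1) :
    ∃ f : UnitFun Ω, (fun x => (f.1 x : ℝ)) =ᵐ[μ] g := by
  refine ⟨⟨fun x => clip (hg.mk g x),
    continuous_clip.measurable.comp hg.stronglyMeasurable_mk.measurable⟩, ?_⟩
  filter_upwards [hg.ae_eq_mk, h] with x hx hx'
  rw [← hx, coe_clip hx']

/-- The truncation of a bounded function to `[-1, 1]`. -/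
noncomputable def clipLinf (v : Lp ℝ ∞ μ) : Lp ℝ ∞ μ :=
  (memLp_coe_clip_comp ∞ μ (f := fun x => clip (v x)) (continuous_clip.measurable.comp_aemeasurable
    (Lp.aestronglyMeasurable v).aemeasurable)).toLp _

theorem coeFn_clipLinf (v : Lp ℝ ∞ μ) : clipLinf μ v =ᵐ[μ] fun x => (clip (v x) : ℝ) :=
  MemLp.coeFn_toLp _

/-- The linear function on the cube with coefficients `c`. -/
noncomputable def cubeComb {I : Type*} (c : I →₀ ℝ) (x : Cube I) : ℝ := c.sum fun i a => a * x i

theorem continuous_cubeComb {I : Type*} (c : I →₀ ℝ) : Continuous (cubeComb c) :=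
  continuous_finsetSum _ fun i _ =>
    continuous_const.mul (continuous_subtype_val.comp (continuous_apply i))

/-- Linear combinations of the functions `e i` in `L^∞`. -/
noncomputable def combLinf {I : Type*} (e : I → UnitFun Ω) : (I →₀ ℝ) →ₗ[ℝ] Lp ℝ ∞ μ :=
  Finsupp.linearCombination ℝ fun i => (e i).toLinf μ

theorem combLinf_single {I : Type*} (e : I → UnitFun Ω) (i : I) :
    combLinf μ e (Finsupp.single i 1) = (e i).toLinf μ := by
  simp [combLinf]

theorem coeFn_combLinf {I : Type*} (e : I → UnitFun Ω) (c : I →₀ ℝ) :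
    combLinf μ e c =ᵐ[μ] fun x => cubeComb c fun i => (e i).1 x := by
  induction c using Finsupp.induction_linear with
  | zero =>
    rw [map_zero]
    filter_upwards [Lp.coeFn_zero ℝ ∞ μ] with x hx
    rw [hx]
    simp [cubeComb]
  | add f g hf hg =>
    rw [map_add]
    filter_upwards [hf, hg, Lp.coeFn_add (combLinf μ e f) (combLinf μ e g)] with x h1 h2 h3
    rw [h3, Pi.add_apply, h1, h2, cubeComb, cubeComb, cubeComb, Finsupp.sum_add_index']
    · simp
    · intros
      ring
  | single i a =>
    have : combLinf μ e (Finsupp.single i a) = a • (e i).toLinf μ := by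
      simp [combLinf]
    rw [this]
    filter_upwards [Lp.coeFn_smul a ((e i).toLinf μ), (e i).coeFn_toLinf μ] with x h1 h2
    rw [h1, Pi.smul_apply, h2, cubeComb, Finsupp.sum_single_index] <;> simp

end UnitFun

/-! ### Limits of families of functions -/

/-- A countable family of sequences of functions `e i n : Ω_n → [-1, 1]`, closed under products and
under the action of the operators `A_n`, together with the limit `ν` of their joint laws. -/
structure LimitSystem (A : ℕ → POperator.{u}) (F : Filter ℕ) where
  I : Type u
  [countable : Countable I]
  e : I → ∀ n, UnitFun (A n).Ω
  act : I → I
  act_spec : ∀ i n, (A n).op ((e i n).toLinf (A n).μ) =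
    inclL1 (A n).μ ((e (act i) n).toLinf (A n).μ)
  mul : I → I → I
  mul_spec : ∀ i j n x, ((e (mul i j) n).1 x : ℝ) = (e i n).1 x * (e j n).1 x
  one : I
  one_spec : ∀ n x, ((e one n).1 x : ℝ) = 1
  ν : Measure (Cube I)
  [prob : IsProbabilityMeasure ν]
  tendsto_integral : ∀ φ : Cube I → ℝ, Continuous φ →
    Tendsto (fun n => ∫ x, φ (fun i => (e i n).1 x) ∂(A n).μ) F (𝓝 (∫ x, φ x ∂ν))

attribute [instance] LimitSystem.countable LimitSystem.prob

namespace LimitSystem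

variable {A : ℕ → POperator.{u}} {F : Filter ℕ} (S : LimitSystem A F)

/-- The coordinate functions on the limit space. -/
def coord (i : S.I) : UnitFun (Cube S.I) := ⟨fun x => x i, measurable_pi_apply i⟩

/-- The map from finite formal linear combinations to `L^∞` of the limit space. -/
noncomputable def comb : (S.I →₀ ℝ) →ₗ[ℝ] Lp ℝ ∞ S.ν := combLinf S.ν S.coord

/-- The map from finite formal linear combinations to `L^∞(Ω_n)`. -/
noncomputable def combAt (n : ℕ) : (S.I →₀ ℝ) →ₗ[ℝ] Lp ℝ ∞ (A n).μ :=
  combLinf (A n).μ fun i => S.e i n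

theorem coeFn_comb (c : S.I →₀ ℝ) : S.comb c =ᵐ[S.ν] cubeComb c := coeFn_combLinf _ _ c

theorem coeFn_combAt (n : ℕ) (c : S.I →₀ ℝ) :
    S.combAt n c =ᵐ[(A n).μ] fun x => cubeComb c fun i => (S.e i n).1 x := coeFn_combLinf _ _ c

/-- The action on formal linear combinations. -/
noncomputable def actComb : (S.I →₀ ℝ) →ₗ[ℝ] (S.I →₀ ℝ) := Finsupp.lmapDomain ℝ ℝ S.act

theorem op_combAt (n : ℕ) (c : S.I →₀ ℝ) :
    (A n).op (S.combAt n c) = inclL1 _ (S.combAt n (S.actComb c)) := by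
  have : (A n).op.toLinearMap ∘ₗ S.combAt n =
      (inclL1 (A n).μ).toLinearMap ∘ₗ S.combAt n ∘ₗ S.actComb := by
    refine Finsupp.lhom_ext' fun i => LinearMap.ext_ring ?_
    simpa [combAt, combLinf, actComb] using S.act_spec i n
  exact LinearMap.congr_fun this c

theorem tendsto_integral_comp_combAt {φ : ℝ → ℝ} (hφ : Continuous φ) (c : S.I →₀ ℝ) :
    Tendsto (fun n => ∫ x, φ (S.combAt n c x) ∂(A n).μ) F (𝓝 (∫ x, φ (S.comb c x) ∂S.ν)) := by
  have h := S.tendsto_integral (fun x => φ (cubeComb c x)) (hφ.comp (continuous_cubeComb c))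
  have e : ∫ x, φ (S.comb c x) ∂S.ν = ∫ x, φ (cubeComb c x) ∂S.ν :=
    integral_congr_ae ((S.coeFn_comb c).fun_comp φ)
  rw [e]
  refine h.congr fun n => (integral_congr_ae ((S.coeFn_combAt n c).fun_comp φ)).symm

theorem tendsto_norm_combAt (c : S.I →₀ ℝ) :
    Tendsto (fun n => ‖inclL1 _ (S.combAt n c)‖) F (𝓝 ‖inclL1 _ (S.comb c)‖) := by
  simp only [norm_inclL1]
  exact S.tendsto_integral_comp_combAt continuous_abs c

/-- The map from finite formal linear combinations to `L^1` of the limit space. -/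
noncomputable def combL1 : (S.I →₀ ℝ) →ₗ[ℝ] Lp ℝ 1 S.ν := (inclL1 S.ν).toLinearMap ∘ₗ S.comb

/-- The contraction holds for each A_n, and both norms are limits of the norms at stage n. In
particular combinations that agree ν-a.e. have images that agree ν-a.e., so the limit operator is
well defined. -/
theorem norm_combL1_actComb_le [F.NeBot] (hA : ∀ n, (A n).IsMarkovGraphop) (c : S.I →₀ ℝ) :
    ‖S.combL1 (S.actComb c)‖ ≤ ‖S.combL1 c‖ := by
  refine le_of_tendsto_of_tendsto' (S.tendsto_norm_combAt (S.actComb c))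
    (S.tendsto_norm_combAt c) fun n => ?_
  rw [← S.op_combAt]
  exact (hA n).norm_apply_le _

/-- The defect is a continuous function on the cube that vanishes identically at every stage, so its
ν-integral is zero. -/
theorem coord_mul_ae [F.NeBot] (i j : S.I) :
    ∀ᵐ x ∂S.ν, (x (S.mul i j) : ℝ) = x i * x j := by
  have hc : Continuous fun x : Cube S.I => |(x (S.mul i j) : ℝ) - x i * x j| := by fun_prop
  have h := S.tendsto_integral _ hc
  simp only [S.mul_spec, sub_self, abs_zero, integral_zero] at h
  have h0 := tendsto_nhds_unique h tendsto_const_nhds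
  have hint : Integrable (fun x : Cube S.I => |(x (S.mul i j) : ℝ) - x i * x j|) S.ν :=
    hc.integrable_of_hasCompactSupport (HasCompactSupport.of_compactSpace _)
  filter_upwards [(integral_eq_zero_iff_of_nonneg (fun x => abs_nonneg _) hint).1 h0] with x hx
  exact sub_eq_zero.1 (abs_eq_zero.1 hx)

theorem coord_one_ae [F.NeBot] : ∀ᵐ x ∂S.ν, (x S.one : ℝ) = 1 := by
  have hc : Continuous fun x : Cube S.I => |(x S.one : ℝ) - 1| := by fun_prop
  have h := S.tendsto_integral _ hc
  simp only [S.one_spec, sub_self, abs_zero, integral_zero] at h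
  have h0 := tendsto_nhds_unique h tendsto_const_nhds
  have hint : Integrable (fun x : Cube S.I => |(x S.one : ℝ) - 1|) S.ν :=
    hc.integrable_of_hasCompactSupport (HasCompactSupport.of_compactSpace _)
  filter_upwards [(integral_eq_zero_iff_of_nonneg (fun x => abs_nonneg _) hint).1 h0] with x hx
  exact sub_eq_zero.1 (abs_eq_zero.1 hx)

/-- The coordinate functions as continuous functions. -/
def coordC (i : S.I) : C(Cube S.I, ℝ) :=
  ⟨fun x => (x i : ℝ), continuous_subtype_val.comp (continuous_apply i)⟩

theorem exists_coord_ae_eq [F.NeBot] {f : C(Cube S.I, ℝ)}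
    (hf : f ∈ Submonoid.closure (Set.range S.coordC)) : ∃ i, ∀ᵐ x ∂S.ν, f x = (x i : ℝ) := by
  induction hf using Submonoid.closure_induction with
  | mem f hf =>
    obtain ⟨i, rfl⟩ := hf
    exact ⟨i, Eventually.of_forall fun x => rfl⟩
  | one =>
    refine ⟨S.one, ?_⟩
    filter_upwards [S.coord_one_ae] with x hx
    rw [hx, ContinuousMap.one_apply]
  | mul f g _ _ hf hg =>
    obtain ⟨i, hi⟩ := hf
    obtain ⟨j, hj⟩ := hg
    refine ⟨S.mul i j, ?_⟩
    filter_upwards [hi, hj, S.coord_mul_ae i j] with x h1 h2 h3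
    rw [h3, ContinuousMap.mul_apply, h1, h2]

theorem toLp_mem_range_combL1 [F.NeBot] {f : C(Cube S.I, ℝ)}
    (hf : f ∈ Algebra.adjoin ℝ (Set.range S.coordC)) :
    ContinuousMap.toLp 1 S.ν ℝ f ∈ LinearMap.range S.combL1 := by
  rw [← Subalgebra.mem_toSubmodule, Algebra.adjoin_eq_span] at hf
  suffices h : Submodule.span ℝ (Submonoid.closure (Set.range S.coordC) : Set C(Cube S.I, ℝ)) ≤
      (LinearMap.range S.combL1).comap (ContinuousMap.toLp 1 S.ν ℝ).toLinearMap from h hf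
  rw [Submodule.span_le]
  intro g hg
  obtain ⟨i, hi⟩ := S.exists_coord_ae_eq hg
  refine ⟨Finsupp.single i 1, ?_⟩
  change inclL1 S.ν (combLinf _ _ _) = ContinuousMap.toLp 1 S.ν ℝ g
  rw [combLinf_single]
  refine Lp.ext ?_
  filter_upwards [coeFn_inclL1 ((S.coord i).toLinf S.ν), (S.coord i).coeFn_toLinf S.ν,
    ContinuousMap.coeFn_toLp (p := 1) (𝕜 := ℝ) S.ν g, hi] with x h1 h2 h3 h4
  rw [h1, h2, h3, h4]
  rfl

/-- The coordinates separate points, so their algebra is uniformly dense in the continuous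
functions, which are dense in L¹. Monomials are ν-a.e. single coordinates, so this algebra already
lies in the linear span of the coordinates. -/
theorem denseRange_combL1 [F.NeBot] : DenseRange S.combL1 := by
  have h1 : DenseRange (ContinuousMap.toLp 1 S.ν ℝ : C(Cube S.I, ℝ) →L[ℝ] Lp ℝ 1 S.ν) :=
    ContinuousMap.toLp_denseRange ℝ S.ν ℝ ENNReal.one_ne_top
  have h2 : Dense (Algebra.adjoin ℝ (Set.range S.coordC) : Set C(Cube S.I, ℝ)) := by
    have := ContinuousMap.subalgebra_topologicalClosure_eq_top_of_separatesPoints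
      (Algebra.adjoin ℝ (Set.range S.coordC)) (by
        intro x y hxy
        obtain ⟨i, hi⟩ := Function.ne_iff.1 hxy
        refine ⟨_, ⟨S.coordC i, Algebra.subset_adjoin ⟨i, rfl⟩, rfl⟩, ?_⟩
        exact fun h => hi (Subtype.ext h))
    rw [dense_iff_closure_eq, ← Subalgebra.topologicalClosure_coe, this]
    rfl
  refine (h1.dense_image (ContinuousMap.toLp 1 S.ν ℝ).continuous h2).mono ?_
  rintro _ ⟨f, hf, rfl⟩
  exact S.toLp_mem_range_combL1 hf

/-- The limit operator. -/
noncomputable def op : POp S.ν :=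
  ((S.combL1 ∘ₗ S.actComb).extendOfNorm S.combL1).comp (inclL1 S.ν)

theorem op_comb [F.NeBot] (hA : ∀ n, (A n).IsMarkovGraphop) (c : S.I →₀ ℝ) :
    S.op (S.comb c) = inclL1 S.ν (S.comb (S.actComb c)) :=
  LinearMap.extendOfNorm_eq (f := S.combL1 ∘ₗ S.actComb) S.denseRange_combL1
    ⟨1, fun c => (S.norm_combL1_actComb_le hA c).trans_eq (one_mul _).symm⟩ c

theorem norm_op_le [F.NeBot] (hA : ∀ n, (A n).IsMarkovGraphop) (v : Lp ℝ ∞ S.ν) :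
    ‖S.op v‖ ≤ ‖inclL1 S.ν v‖ := by
  have := LinearMap.norm_extendOfNorm_apply_le (f := S.combL1 ∘ₗ S.actComb) S.denseRange_combL1 1
    (fun c => (S.norm_combL1_actComb_le hA c).trans_eq (one_mul _).symm) (inclL1 S.ν v)
  rwa [one_mul] at this

/-- The limit operator with its probability space. -/
noncomputable def limit : POperator.{u} where
  Ω := Cube S.I
  μ := S.ν
  op := S.op

end LimitSystem

/-! ### Profiles of the limit operator -/

namespace LimitSystem

variable {A : ℕ → POperator.{u}} {F : Filter ℕ} (S : LimitSystem A F)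

/-- The joint vector of the linear combinations `c_1, …, c_k` and their images. -/
noncomputable def combVec {k : ℕ} (c : Fin k → S.I →₀ ℝ) (x : Cube S.I) : Fin k ⊕ Fin k → ℝ :=
  Sum.elim (fun i => cubeComb (c i) x) fun i => cubeComb (S.actComb (c i)) x

theorem continuous_combVec {k : ℕ} (c : Fin k → S.I →₀ ℝ) : Continuous (S.combVec c) := by
  refine continuous_pi fun i => ?_
  cases i with
  | inl i => exact continuous_cubeComb _
  | inr i => exact continuous_cubeComb _

theorem jointVec_comb [F.NeBot] (hA : ∀ n, (A n).IsMarkovGraphop) {k : ℕ}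
    (c : Fin k → S.I →₀ ℝ) : (S.op.jointVec fun i => S.comb (c i)) =ᵐ[S.ν] S.combVec c := by
  have h1 := ae_all_iff.2 fun i => S.coeFn_comb (c i)
  have h2 := ae_all_iff.2 fun i => S.coeFn_comb (S.actComb (c i))
  have h3 := ae_all_iff.2 fun i => coeFn_inclL1 (S.comb (S.actComb (c i)))
  filter_upwards [h1, h2, h3] with x h1 h2 h3
  funext i
  cases i with
  | inl i => exact h1 i
  | inr i =>
    change S.op (S.comb (c i)) x = _
    rw [S.op_comb hA, h3, h2]
    rfl

theorem jointVec_combAt {k : ℕ} (c : Fin k → S.I →₀ ℝ) (n : ℕ) :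
    ((A n).op.jointVec fun i => S.combAt n (c i)) =ᵐ[(A n).μ]
      fun x => S.combVec c fun i => (S.e i n).1 x := by
  have h1 := ae_all_iff.2 fun i => S.coeFn_combAt n (c i)
  have h2 := ae_all_iff.2 fun i => S.coeFn_combAt n (S.actComb (c i))
  have h3 := ae_all_iff.2 fun i => coeFn_inclL1 (S.combAt n (S.actComb (c i)))
  filter_upwards [h1, h2, h3] with x h1 h2 h3
  funext i
  cases i with
  | inl i => exact h1 i
  | inr i =>
    change (A n).op (S.combAt n (c i)) x = _
    rw [S.op_combAt, h3, h2]
    rfl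

/-- All these laws are images of the laws on the cube under the same continuous map `combVec c`. -/
theorem tendsto_jointLaw_combAt [F.NeBot] (hA : ∀ n, (A n).IsMarkovGraphop) {k : ℕ}
    (c : Fin k → S.I →₀ ℝ) :
    Tendsto (fun n => LevyProkhorov.ofMeasure ((A n).op.jointLaw fun i => S.combAt n (c i))) F
      (𝓝 (LevyProkhorov.ofMeasure (S.op.jointLaw fun i => S.comb (c i)))) := by
  refine (LevyProkhorov.continuous_ofMeasure_probabilityMeasure.tendsto _).comp ?_
  rw [ProbabilityMeasure.tendsto_iff_forall_integral_tendsto]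
  intro ψ
  have h := S.tendsto_integral (fun x => ψ (WithLp.toLp 2 (S.combVec c x)))
    (ψ.continuous.comp ((PiLp.continuous_toLp 2 _).comp (S.continuous_combVec c)))
  have e1 : ∫ y, ψ y ∂(S.op.jointLaw fun i => S.comb (c i) : Measure (EuclideanSpace ℝ _)) =
      ∫ x, ψ (WithLp.toLp 2 (S.combVec c x)) ∂S.ν := by
    rw [POp.toMeasure_jointLaw, integral_map (POp.aemeasurable_toLp_jointVec _ _)
      ψ.continuous.aestronglyMeasurable]
    refine integral_congr_ae ?_
    filter_upwards [S.jointVec_comb hA c] with x hx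
    rw [hx]
  have e2 : ∀ n, ∫ y, ψ y ∂((A n).op.jointLaw fun i => S.combAt n (c i) :
      Measure (EuclideanSpace ℝ _)) =
      ∫ x, ψ (WithLp.toLp 2 (S.combVec c fun i => (S.e i n).1 x)) ∂(A n).μ := by
    intro n
    rw [POp.toMeasure_jointLaw, integral_map (POp.aemeasurable_toLp_jointVec _ _)
      ψ.continuous.aestronglyMeasurable]
    refine integral_congr_ae ?_
    filter_upwards [S.jointVec_combAt c n] with x hx
    rw [hx]
  rw [e1]
  exact h.congr fun n => (e2 n).symm

theorem clipLinf_mem_profile {Ω : Type u} [MeasurableSpace Ω] {μ : Measure Ω}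
    [IsProbabilityMeasure μ] (B : POp μ) {k : ℕ} (v : Fin k → Lp ℝ ∞ μ) :
    LevyProkhorov.ofMeasure (B.jointLaw fun i => clipLinf μ (v i)) ∈ B.profile k := by
  refine ⟨_, fun i => ?_, rfl⟩
  filter_upwards [coeFn_clipLinf μ (v i)] with x hx
  rw [hx]
  exact (clip (v i x)).2

theorem exists_comb_near [F.NeBot] (v : Lp ℝ ∞ S.ν) {η : ℝ} (hη : 0 < η) :
    ∃ c, ‖inclL1 S.ν (v - S.comb c)‖ < η := by
  obtain ⟨c, hc⟩ := S.denseRange_combL1.exists_dist_lt (inclL1 S.ν v) hη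
  refine ⟨c, ?_⟩
  rwa [dist_eq_norm, combL1, LinearMap.comp_apply, ContinuousLinearMap.coe_coe, ← map_sub] at hc

/-- A combination near v may leave [-1,1]. In the limit the truncation error is at most the distance
to v, and this error is the limit of those at stage n. -/
theorem eventually_norm_clip_sub_lt {v : Lp ℝ ∞ S.ν} (hv : ∀ᵐ x ∂S.ν, v x ∈ Set.Icc (-1 : ℝ) 1)
    {c : S.I →₀ ℝ} {η : ℝ} (hc : ‖inclL1 S.ν (v - S.comb c)‖ < η) :
    ∀ᶠ n in F, ‖inclL1 (A n).μ (S.combAt n c - clipLinf (A n).μ (S.combAt n c))‖ < η := by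
  have h := S.tendsto_integral_comp_combAt (φ := fun y => |(clip y : ℝ) - y|)
    ((continuous_subtype_val.comp continuous_clip).sub continuous_id).abs c
  have hlt : ∫ x, |(clip (S.comb c x) : ℝ) - S.comb c x| ∂S.ν < η := by
    refine lt_of_le_of_lt ?_ hc
    rw [norm_inclL1_sub]
    refine integral_mono_ae ?_ ?_ ?_
    · refine Integrable.abs (Integrable.sub ?_ (integrable_Linfty _))
      exact (integrable_Linfty _).congr (coeFn_clipLinf S.ν (S.comb c))
    · exact ((integrable_Linfty _).sub (integrable_Linfty _)).abs
    · filter_upwards [hv] with x hx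
      exact abs_clip_sub_le _ (abs_le.2 hx)
  filter_upwards [h.eventually_lt_const hlt] with n hn
  rw [norm_inclL1_sub]
  refine lt_of_eq_of_lt (integral_congr_ae ?_) hn
  filter_upwards [coeFn_clipLinf (A n).μ (S.combAt n c)] with x hx
  rw [hx, abs_sub_comm]

/-- Three steps of size ε/3: from v to a combination of coordinates, from there to the same
combination at stage n, and from that to its truncation, which is admissible in the profile. -/
theorem eventually_exists_mem_profile [F.NeBot] (hA : ∀ n, (A n).IsMarkovGraphop) {k : ℕ}
    {ρ : LevyProkhorov (ProbabilityMeasure (EuclideanSpace ℝ (Fin k ⊕ Fin k)))}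
    (hρ : ρ ∈ S.limit.profile k) {ε : ℝ} (hε : 0 < ε) :
    ∀ᶠ n in F, ∃ σ ∈ (A n).profile k, dist σ ρ < ε := by
  obtain ⟨v, hv, rfl⟩ := hρ
  have hδ : 0 < ε / 3 := by positivity
  -- Dividing by k + 1 instead of k covers k = 0.
  have hη : 0 < (ε / 3) ^ 2 / 2 / (k + 1) := by positivity
  have hsum : ∀ a : Fin k → ℝ, (∀ i, a i < (ε / 3) ^ 2 / 2 / (k + 1)) →
      ∑ i, a i ≤ (ε / 3) ^ 2 / 2 := by
    intro a ha
    refine (Finset.sum_le_sum fun i _ => (ha i).le).trans ?_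
    rw [Finset.sum_const, Finset.card_univ, Fintype.card_fin, nsmul_eq_mul, mul_div_assoc',
      div_le_iff₀ (by positivity)]
    nlinarith [sq_nonneg (ε / 3)]
  choose c hc using fun i => S.exists_comb_near (v i) hη
  have h1 : dist (LevyProkhorov.ofMeasure (S.op.jointLaw v))
      (LevyProkhorov.ofMeasure (S.op.jointLaw fun i => S.comb (c i))) ≤ ε / 3 :=
    S.op.dist_jointLaw_le (S.norm_op_le hA) _ _ hδ (hsum _ hc)
  have h2 := (tendsto_iff_dist_tendsto_zero.1 (S.tendsto_jointLaw_combAt hA c)).eventually_lt_const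
    hδ
  have h3 := eventually_all.2 fun i => S.eventually_norm_clip_sub_lt (hv i) (hc i)
  filter_upwards [h2, h3] with n h2 h3
  refine ⟨_, clipLinf_mem_profile (A n).op fun i => S.combAt n (c i), ?_⟩
  have h4 := (A n).op.dist_jointLaw_le (hA n).norm_apply_le (fun i => S.combAt n (c i))
    (fun i => clipLinf _ (S.combAt n (c i))) hδ (hsum _ h3)
  rw [dist_comm] at h1 h4
  refine (dist_triangle4 _ _ _ _).trans_lt ((add_lt_add_of_lt_of_le
    (add_lt_add_of_le_of_lt h4 h2) h1).trans_eq ?_)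
  ring

theorem isMarkovGraphop_limit [F.NeBot] (hA : ∀ n, (A n).IsMarkovGraphop) :
    S.limit.IsMarkovGraphop := by
  refine POp.IsMarkovLimit.isMarkovGraphop fun k ρ hρ ε hε => ?_
  obtain ⟨n, σ, hσ, hd⟩ := (S.eventually_exists_mem_profile hA hρ hε).exists
  exact ⟨A n, hA n, σ, hσ, hd⟩

/-- Total boundedness of the limit profile makes the pointwise approximation uniform through a
finite ε/2-net. -/
theorem eventually_forall_exists_mem_profile [F.NeBot] (hA : ∀ n, (A n).IsMarkovGraphop) (k : ℕ)
    {ε : ℝ} (hε : 0 < ε) :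
    ∀ᶠ n in F, ∀ ρ ∈ S.limit.profile k, ∃ σ ∈ (A n).profile k, dist ρ σ < ε := by
  have htb : TotallyBounded (S.limit.profile k) :=
    isCompact_range_cubeLaw.totallyBounded.subset
      (POp.IsMarkovGraphop.profile_subset (S.isMarkovGraphop_limit hA) k)
  obtain ⟨t, ht, htf, htc⟩ := Metric.finite_approx_of_totallyBounded htb (ε / 2) (half_pos hε)
  have h := (eventually_all_finite htf).2 fun ρ hρ =>
    S.eventually_exists_mem_profile hA (ht hρ) (half_pos hε)
  filter_upwards [h] with n hn ρ hρ
  obtain ⟨ρ', hρ', hd⟩ := Set.mem_iUnion₂.1 (htc hρ)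
  obtain ⟨σ, hσ, hd'⟩ := hn ρ' hρ'
  refine ⟨σ, hσ, ?_⟩
  rw [dist_comm] at hd'
  exact (dist_triangle _ ρ' _).trans_lt
    ((add_lt_add (Metric.mem_ball.1 hd) hd').trans_eq (add_halves ε))

theorem exists_mem_profile_tendsto [F.NeBot] (hA : ∀ n, (A n).IsMarkovGraphop) {k : ℕ}
    (f : Fin k → S.I) :
    ∃ ρ ∈ S.limit.profile k, Tendsto (fun n => LevyProkhorov.ofMeasure
      ((A n).op.jointLaw fun i => (S.e (f i) n).toLinf (A n).μ)) F (𝓝 ρ) := by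
  have h := S.tendsto_jointLaw_combAt hA fun i => Finsupp.single (f i) 1
  simp only [combAt, comb, combLinf_single] at h
  exact ⟨_, ⟨_, fun i => UnitFun.toLinf_mem_Icc _ _, rfl⟩, h⟩

end LimitSystem

/-! ### Existence of limit systems -/

theorem exists_countable_closure {T : Type*} {s : Set T} (hs : s.Countable) (α : T → T)
    (m : T → T → T) :
    ∃ t, s ⊆ t ∧ t.Countable ∧ (∀ x ∈ t, α x ∈ t) ∧ ∀ x ∈ t, ∀ y ∈ t, m x y ∈ t := by
  let g : Set T → Set T := fun t => t ∪ (α '' t ∪ Set.image2 m t t)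
  have hmono : Monotone fun n => g^[n] s := monotone_nat_of_le_succ fun n => by
    rw [Function.iterate_succ_apply']
    exact Set.subset_union_left
  refine ⟨⋃ n, g^[n] s, Set.subset_iUnion (fun n => g^[n] s) 0, ?_, ?_, ?_⟩
  · refine Set.countable_iUnion fun n => ?_
    induction n with
    | zero => exact hs
    | succ n ih =>
      rw [Function.iterate_succ_apply']
      exact ih.union ((ih.image α).union (ih.image2 ih m))
  · intro x hx
    obtain ⟨n, hn⟩ := Set.mem_iUnion.1 hx
    refine Set.mem_iUnion.2 ⟨n + 1, ?_⟩
    rw [Function.iterate_succ_apply']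
    exact Or.inr (Or.inl ⟨x, hn, rfl⟩)
  · intro x hx y hy
    obtain ⟨n, hn⟩ := Set.mem_iUnion.1 hx
    obtain ⟨p, hp⟩ := Set.mem_iUnion.1 hy
    refine Set.mem_iUnion.2 ⟨max n p + 1, ?_⟩
    rw [Function.iterate_succ_apply']
    exact Or.inr (Or.inr ⟨x, hmono (le_max_left n p) hn, y, hmono (le_max_right n p) hp, rfl⟩)

theorem POp.IsMarkovGraphop.exists_unitFun_apply {Ω : Type u} [MeasurableSpace Ω] {μ : Measure Ω}
    [IsProbabilityMeasure μ] {A : POp μ} (hA : A.IsMarkovGraphop) (f : UnitFun Ω) :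
    ∃ g : UnitFun Ω, A (f.toLinf μ) = inclL1 μ (g.toLinf μ) := by
  obtain ⟨g, hg⟩ := exists_unitFun μ (Lp.aestronglyMeasurable (A (f.toLinf μ)))
    (hA.abs_apply_le_one ((f.toLinf_mem_Icc μ).mono fun x hx => abs_le.2 hx))
  refine ⟨g, Lp.ext ?_⟩
  filter_upwards [hg, coeFn_inclL1 (g.toLinf μ), g.coeFn_toLinf μ] with x h1 h2 h3
  rw [h2, h3, h1]

/-- The pointwise product of functions with values in `[-1, 1]`. -/
def UnitFun.mul {Ω : Type u} [MeasurableSpace Ω] (f g : UnitFun Ω) : UnitFun Ω :=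
  ⟨fun x => ⟨f.1 x * g.1 x, abs_le.1 (by
    rw [abs_mul]
    exact mul_le_one₀ (abs_le.2 (f.1 x).2) (abs_nonneg _) (abs_le.2 (g.1 x).2))⟩,
    ((measurable_subtype_coe.comp f.2).mul (measurable_subtype_coe.comp g.2)).subtype_mk⟩

/-- The constant function `1`. -/
def UnitFun.const_one (Ω : Type u) [MeasurableSpace Ω] : UnitFun Ω :=
  ⟨fun _ => ⟨1, by norm_num⟩, measurable_const⟩

theorem exists_limitSystem {A : ℕ → POperator.{u}} (hA : ∀ n, (A n).IsMarkovGraphop)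
    (F : Ultrafilter ℕ) {s : Set (∀ n, UnitFun (A n).Ω)} (hs : s.Countable) :
    ∃ S : LimitSystem A F, ∀ f ∈ s, ∃ i, S.e i = f := by
  choose α hα using fun n => POp.IsMarkovGraphop.exists_unitFun_apply (hA n)
  obtain ⟨t, hst, htc, htα, htm⟩ := exists_countable_closure
    (hs.insert fun n => UnitFun.const_one (A n).Ω)
    (fun f n => α n (f n)) (fun f g n => (f n).mul (g n))
  have : Countable t := htc.to_subtype
  have hΨ : ∀ n, Measurable fun (x : (A n).Ω) (f : t) => (f.1 n).1 x :=
    fun n => measurable_pi_lambda _ fun f => (f.1 n).2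
  let P : ℕ → ProbabilityMeasure (Cube t) := fun n =>
    ⟨(A n).μ.map fun x f => (f.1 n).1 x, Measure.isProbabilityMeasure_map (hΨ n).aemeasurable⟩
  -- The probability measures on the compact cube form a compact space, so the joint laws converge
  -- along the ultrafilter.
  obtain ⟨ν, -, hν⟩ := isCompact_univ.ultrafilter_le_nhds (F.map P) (by simp)
  replace hν : Tendsto P F (𝓝 ν) := hν
  refine ⟨{
    I := t
    e := fun f => f.1
    act := fun f => ⟨_, htα f.1 f.2⟩
    act_spec := fun f n => hα n _
    mul := fun f g => ⟨_, htm f.1 f.2 g.1 g.2⟩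
    mul_spec := fun f g n x => rfl
    one := ⟨_, hst (Set.mem_insert _ _)⟩
    one_spec := fun n x => rfl
    ν := ν
    tendsto_integral := fun φ hφ => ?_ }, fun f hf => ⟨⟨f, hst (Set.mem_insert_of_mem _ hf)⟩, rfl⟩⟩
  have h := (ProbabilityMeasure.tendsto_iff_forall_integral_tendsto.1 hν)
    (BoundedContinuousFunction.mkOfCompact ⟨φ, hφ⟩)
  refine h.congr fun n => ?_
  exact integral_map (hΨ n).aemeasurable hφ.aestronglyMeasurable

/-! ### Compactness of the set of Markov graphops -/

section Compactness

/-- The joint law of functions with values in `[-1, 1]`. -/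
noncomputable def POperator.unitLaw (A : POperator.{u}) {k : ℕ} (f : Fin k → UnitFun A.Ω) :
    LevyProkhorov (ProbabilityMeasure (EuclideanSpace ℝ (Fin k ⊕ Fin k))) :=
  LevyProkhorov.ofMeasure (A.op.jointLaw fun i => (f i).toLinf A.μ)

theorem POperator.unitLaw_mem_profile (A : POperator.{u}) {k : ℕ} (f : Fin k → UnitFun A.Ω) :
    A.unitLaw f ∈ A.profile k :=
  ⟨_, fun i => (f i).toLinf_mem_Icc A.μ, rfl⟩

theorem POperator.exists_unitLaw_eq (A : POperator.{u}) {k : ℕ}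
    {ρ : LevyProkhorov (ProbabilityMeasure (EuclideanSpace ℝ (Fin k ⊕ Fin k)))}
    (hρ : ρ ∈ A.profile k) : ∃ f : Fin k → UnitFun A.Ω, A.unitLaw f = ρ := by
  obtain ⟨v, hv, rfl⟩ := hρ
  choose f hf using fun i => exists_unitFun A.μ (Lp.aestronglyMeasurable (v i))
    ((hv i).mono fun x hx => abs_le.2 hx)
  refine ⟨f, ?_⟩
  have : (fun i => (f i).toLinf A.μ) = v := by
    funext i
    exact Lp.ext (((f i).coeFn_toLinf A.μ).trans (hf i))
  rw [POperator.unitLaw, this]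

theorem profileDist_le {k : ℕ} {A B : POperator.{u}} {ε : ℝ} (hε : 0 ≤ ε)
    (h1 : ∀ ρ ∈ A.profile k, ∃ σ ∈ B.profile k, dist ρ σ < ε)
    (h2 : ∀ ρ ∈ B.profile k, ∃ σ ∈ A.profile k, dist ρ σ < ε) : profileDist k A B ≤ ε :=
  Metric.hausdorffDist_le_of_mem_dist hε (fun ρ hρ => (h1 ρ hρ).imp fun _ h => ⟨h.1, h.2.le⟩)
    fun ρ hρ => (h2 ρ hρ).imp fun _ h => ⟨h.1, h.2.le⟩

theorem tendsto_dM_of_tendsto_profileDist {J : Type*} {F : Filter J} {A : J → POperator.{u}}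
    {B : POperator.{u}} (h : ∀ k, Tendsto (fun n => profileDist k (A n) B) F (𝓝 0)) :
    Tendsto (fun n => dM (A n) B) F (𝓝 0) := by
  have hs : Summable fun k : ℕ => (1 / 2 : ℝ) ^ (k + 1) :=
    (summable_nat_add_iff 1).2 (summable_geometric_of_lt_one (by norm_num) (by norm_num))
  have := tendsto_tsum_of_dominated_convergence (𝓕 := F)
    (f := fun n k => (1 / 2 : ℝ) ^ (k + 1) * profileDist (k + 1) (A n) B) (g := fun _ => 0) hs
    (fun k => by simpa using (h (k + 1)).const_mul ((1 / 2 : ℝ) ^ (k + 1)))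
    (Eventually.of_forall fun n k => by
      rw [Real.norm_of_nonneg (mul_nonneg (by positivity) (profileDist_nonneg _ _ _))]
      exact mul_le_of_le_one_right (by positivity) (profileDist_le_one _ _ _))
  rw [tsum_zero] at this
  exact this

/-- Along the ultrafilter every sequence of k-tuples has a limit law in a compact metric space. One
representative sequence for each point of a countable dense set of limit laws suffices. -/
theorem exists_countable_families {A : ℕ → POperator.{u}} (hA : ∀ n, (A n).IsMarkovGraphop)
    (F : Ultrafilter ℕ) (k : ℕ) :
    ∃ G : Set (Fin k → ∀ n, UnitFun (A n).Ω), G.Countable ∧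
      ∀ f : Fin k → ∀ n, UnitFun (A n).Ω, ∀ ε > 0, ∃ g ∈ G,
        ∀ᶠ n in F, dist ((A n).unitLaw fun i => f i n) ((A n).unitLaw fun i => g i n) < ε := by
  have hlim : ∀ f : Fin k → ∀ n, UnitFun (A n).Ω,
      ∃ ρ ∈ Set.range (cubeLaw (ι := Fin k ⊕ Fin k)),
        Tendsto (fun n => (A n).unitLaw fun i => f i n) F (𝓝 ρ) := fun f =>
    isCompact_range_cubeLaw.ultrafilter_le_nhds (F.map fun n => (A n).unitLaw fun i => f i n)
      (tendsto_principal.2 (Eventually.of_forall fun n =>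
        POp.IsMarkovGraphop.profile_subset (hA n) k ((A n).unitLaw_mem_profile _)))
  choose L hLc hL using hlim
  have hsep : TopologicalSpace.IsSeparable (Set.range L) :=
    (isCompact_range_cubeLaw (ι := Fin k ⊕ Fin k)).isSeparable.mono (Set.range_subset_iff.2 hLc)
  obtain ⟨D, hDs, hDc, hD⟩ := hsep.exists_countable_dense_subset
  have : Nonempty (Fin k → ∀ n, UnitFun (A n).Ω) := ⟨fun _ n => UnitFun.const_one _⟩
  choose! pre hpre using fun d (hd : d ∈ D) => hDs hd
  refine ⟨pre '' D, hDc.image pre, fun f ε hε => ?_⟩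
  obtain ⟨d, hd, hdist⟩ := Metric.mem_closure_iff.1 (hD ⟨f, rfl⟩) ε hε
  refine ⟨pre d, ⟨d, hd, rfl⟩, ?_⟩
  rw [← hpre d hd] at hdist
  exact ((hL f).dist (hL (pre d))).eventually_lt_const hdist

theorem exists_isMarkovGraphop_tendsto {A : ℕ → POperator.{u}}
    (hA : ∀ n, (A n).IsMarkovGraphop) (F : Ultrafilter ℕ) :
    ∃ B : POperator.{u}, B.IsMarkovGraphop ∧ Tendsto (fun n => dM (A n) B) F (𝓝 0) := by
  choose G hGc hG using exists_countable_families hA F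
  obtain ⟨S, hS⟩ := exists_limitSystem hA F (s := ⋃ k, ⋃ f ∈ G k, Set.range f)
    (Set.countable_iUnion fun k => (hGc k).biUnion fun f _ => Set.countable_range f)
  refine ⟨S.limit, S.isMarkovGraphop_limit hA, tendsto_dM_of_tendsto_profileDist fun k => ?_⟩
  have key : ∀ ε > 0, ∀ᶠ n in F, ∀ ρ ∈ (A n).profile k, ∃ σ ∈ S.limit.profile k,
      dist ρ σ < ε := by
    intro ε hε
    by_contra hcon
    -- For an ultrafilter, failure of the property means that it fails for almost all n. The
    -- offending points then form one sequence of k-tuples, whose values at the other n are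
    -- arbitrary.
    rw [← Ultrafilter.eventually_not] at hcon
    have hbad : ∀ n, ∃ f : Fin k → UnitFun (A n).Ω,
        (¬ ∀ ρ ∈ (A n).profile k, ∃ σ ∈ S.limit.profile k, dist ρ σ < ε) →
          ∀ σ ∈ S.limit.profile k, ε ≤ dist ((A n).unitLaw f) σ := by
      intro n
      by_cases h : ∀ ρ ∈ (A n).profile k, ∃ σ ∈ S.limit.profile k, dist ρ σ < ε
      · exact ⟨fun _ => UnitFun.const_one _, fun h' => absurd h h'⟩
      · push Not at h
        obtain ⟨ρ, hρ, h⟩ := h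
        obtain ⟨f, rfl⟩ := (A n).exists_unitLaw_eq hρ
        exact ⟨f, fun _ => h⟩
    choose f hf using hbad
    -- A sequence of the countable family follows the bad one within ε/2, and its own limit law lies
    -- in the limit profile. This contradicts distance at least ε.
    obtain ⟨g, hg, hfg⟩ := hG k (fun i n => f n i) (ε / 2) (half_pos hε)
    choose j hj using fun i => hS (g i)
      (Set.mem_iUnion.2 ⟨k, Set.mem_iUnion₂.2 ⟨g, hg, Set.mem_range_self i⟩⟩)
    obtain ⟨σ, hσ, hlim⟩ := S.exists_mem_profile_tendsto hA j
    simp only [hj] at hlim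
    have h2 := (tendsto_iff_dist_tendsto_zero.1 hlim).eventually_lt_const (half_pos hε)
    obtain ⟨n, h1, h2, h3⟩ := (hcon.and (hfg.and h2)).exists
    refine absurd (hf n h1 σ hσ) (not_le.2 ?_)
    exact (dist_triangle _ _ _).trans_lt ((add_lt_add h2 h3).trans_eq (add_halves ε))
  rw [Metric.tendsto_nhds]
  intro ε hε
  filter_upwards [key (ε / 2) (half_pos hε),
    S.eventually_forall_exists_mem_profile hA k (half_pos hε)] with n h1 h2
  rw [Real.dist_0_eq_abs, abs_of_nonneg (profileDist_nonneg _ _ _)]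
  exact (profileDist_le (half_pos hε).le h1 h2).trans_lt (half_lt_self hε)

/-- A limit along a nonprincipal ultrafilter is a cluster point of the sequence, and in a
pseudometric space a cluster point is the limit of a subsequence. -/
theorem exists_subseq_tendsto_dM {A : ℕ → POperator.{u}} (hA : ∀ n, (A n).IsMarkovGraphop) :
    ∃ B : POperator.{u}, B.IsMarkovGraphop ∧ ∃ φ : ℕ → ℕ, StrictMono φ ∧
      Tendsto (fun n => dM (A (φ n)) B) atTop (𝓝 0) := by
  obtain ⟨B, hB, hlim⟩ := exists_isMarkovGraphop_tendsto hA (hyperfilter ℕ)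
  have hlim' : Tendsto A (hyperfilter ℕ) (𝓝 B) := tendsto_iff_dist_tendsto_zero.2 hlim
  have hc : MapClusterPt B atTop A :=
    hlim'.mapClusterPt.mono (map_mono (Nat.hyperfilter_le_atTop))
  obtain ⟨φ, hφ, h⟩ := MapClusterPt.tendsto_subseq hc
  exact ⟨B, hB, φ, hφ, tendsto_iff_dist_tendsto_zero.1 h⟩

theorem isCompact_markovClasses : IsCompact markovClasses.{u} := by
  refine IsSeqCompact.isCompact fun x hx => ?_
  choose A hA hAx using hx
  obtain ⟨B, hB, φ, hφ, h⟩ := exists_subseq_tendsto_dM hA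
  refine ⟨SeparationQuotient.mk B, ⟨B, hB, rfl⟩, φ, hφ, ?_⟩
  obtain rfl : (fun n => SeparationQuotient.mk (A n)) = x := funext hAx
  exact tendsto_iff_dist_tendsto_zero.2 h

end Compactness

/-! ### Action convergence and the metric `d_M` -/

section ActionConvergence

/-- Action convergence also quantifies over k = 0, which the sum defining `dM` omits. Since ℝ⁰ is a
point, it carries only one law. -/
theorem profileDist_zero (A B : POperator.{u}) : profileDist 0 A B = 0 := by
  have hsub : Subsingleton (LevyProkhorov (ProbabilityMeasure
      (EuclideanSpace ℝ (Fin 0 ⊕ Fin 0)))) := by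
    refine ⟨fun ρ σ => LevyProkhorov.toMeasure_injective ?_⟩
    refine ProbabilityMeasure.toMeasure_injective (Measure.ext fun s _ => ?_)
    rcases Set.eq_empty_or_nonempty s with rfl | h
    · rw [measure_empty, measure_empty]
    · rw [Subsingleton.eq_univ_of_nonempty h, measure_univ, measure_univ]
  have h : ∀ C : POperator.{u}, C.profile 0 = Set.univ := fun C =>
    Subsingleton.eq_univ_of_nonempty (POp.profile_nonempty C.op 0)
  rw [profileDist, h, h, Metric.hausdorffDist_self_zero]

theorem profileDist_le_dM (k : ℕ) (A B : POperator.{u}) :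
    profileDist k A B ≤ 2 ^ k * dM A B := by
  cases k with
  | zero =>
    rw [profileDist_zero]
    exact mul_nonneg (by norm_num) (dist_nonneg (x := A) (y := B))
  | succ k =>
    have h := (dM_summable A B).le_tsum k fun j _ =>
      mul_nonneg (by positivity) (profileDist_nonneg _ _ _)
    rw [← div_le_iff₀' (by positivity), div_eq_inv_mul, ← inv_pow, inv_eq_one_div]
    exact h

theorem actionConvergent_of_tendsto {A : ℕ → POperator.{u}} {B : POperator.{u}}
    (h : Tendsto (fun n => dM (A n) B) atTop (𝓝 0)) : ActionConvergent A := by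
  intro k ε hε
  have hc : CauchySeq A := (tendsto_iff_dist_tendsto_zero.2 h).cauchySeq
  obtain ⟨N, hN⟩ := Metric.cauchySeq_iff.1 hc (ε / 2 ^ k) (by positivity)
  refine ⟨N, fun m hm n hn => (profileDist_le_dM k _ _).trans_lt ?_⟩
  exact (lt_div_iff₀' (by positivity)).1 (hN m hm n hn)

/-- For each k, a Cauchy sequence with a convergent subsequence converges. The levels are then
summed by dominated convergence. -/
theorem tendsto_dM_of_subseq {A : ℕ → POperator.{u}} (hA : ActionConvergent A) {B : POperator.{u}}
    {φ : ℕ → ℕ} (hφ : StrictMono φ) (h : Tendsto (fun n => dM (A (φ n)) B) atTop (𝓝 0)) :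
    Tendsto (fun n => dM (A n) B) atTop (𝓝 0) := by
  refine tendsto_dM_of_tendsto_profileDist fun k => ?_
  have hk : Tendsto (fun n => profileDist k (A (φ n)) B) atTop (𝓝 0) :=
    squeeze_zero (fun n => profileDist_nonneg _ _ _) (fun n => profileDist_le_dM k _ _)
      (by simpa using h.const_mul ((2 : ℝ) ^ k))
  rw [Metric.tendsto_atTop]
  intro ε hε
  obtain ⟨N, hN⟩ := hA k (ε / 2) (half_pos hε)
  obtain ⟨p, hp, hpN⟩ := ((hk.eventually_lt_const (half_pos hε)).and
    (hφ.tendsto_atTop.eventually_ge_atTop N)).exists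
  refine ⟨N, fun n hn => ?_⟩
  rw [Real.dist_0_eq_abs, abs_of_nonneg (profileDist_nonneg _ _ _)]
  exact (profileDist_triangle k _ (A (φ p)) _).trans_lt
    ((add_lt_add (hN n hn _ hpN) hp).trans_eq (add_halves ε))

/-- Hausdorff convergence contains the one-sided approximation required by `POp.IsMarkovLimit`. -/
theorem isMarkovGraphop_of_tendsto_dM {A : ℕ → POperator.{u}} (hA : ∀ n, (A n).IsMarkovGraphop)
    {B : POperator.{u}} (h : Tendsto (fun n => dM (A n) B) atTop (𝓝 0)) : B.IsMarkovGraphop := by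
  refine POp.IsMarkovLimit.isMarkovGraphop fun k ρ hρ ε hε => ?_
  have hk : Tendsto (fun n => profileDist k (A n) B) atTop (𝓝 0) :=
    squeeze_zero (fun n => profileDist_nonneg _ _ _) (fun n => profileDist_le_dM k _ _)
      (by simpa using h.const_mul ((2 : ℝ) ^ k))
  obtain ⟨n, hn⟩ := (hk.eventually_lt_const hε).exists
  obtain ⟨σ, hσ, hd⟩ := Metric.exists_dist_lt_of_hausdorffDist_lt' hρ hn
    (ne_top_of_le_ne_top ENNReal.one_ne_top (hausdorffEDist_profile_le_one k (A n) B))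
  exact ⟨A n, hA n, σ, hσ, hd⟩

end ActionConvergence

/-! ### Random walk operators -/

section RandomWalk

variable {V : Type u} [Fintype V] [MeasurableSpace V] [DiscreteMeasurableSpace V]

theorem integral_rwMeasure (G : SimpleGraph V) [DecidableRel G.Adj] (f : V → ℝ) :
    ∫ i, f i ∂rwMeasure G =
      ∑ i, (G.degree i : ℝ) / (2 * (G.edgeFinset.card : ℝ)) * f i := by
  rw [rwMeasure, integral_finsetSum_measure fun i _ =>
    (integrable_dirac (by simp)).smul_measure ENNReal.ofReal_ne_top]
  refine Finset.sum_congr rfl fun i _ => ?_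
  rw [integral_smul_measure, integral_dirac, ENNReal.toReal_ofReal (by positivity), smul_eq_mul]
  congr!

/-- The degree in ν_G cancels the degree in the average, leaving a sum over ordered adjacent pairs.
Its symmetry is the reversibility of the walk. -/
theorem rwOp_form (G : SimpleGraph V) [DecidableRel G.Adj] (v w : Lp ℝ ∞ (rwMeasure G)) :
    (rwOp G).form v w =
      (2 * (G.edgeFinset.card : ℝ))⁻¹ * ∑ i, ∑ j, if G.Adj i j then v j * w i else 0 := by
  have h : (rwOp G).form v w = ∫ i, rwAverage G v i * w i ∂rwMeasure G := by
    refine integral_congr_ae ?_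
    filter_upwards [rwOp_apply G v] with i hi
    rw [hi]
  rw [h, integral_rwMeasure, Finset.mul_sum]
  refine Finset.sum_congr rfl fun i _ => ?_
  have hsum : rwAverage G v i = (G.degree i : ℝ)⁻¹ * ∑ j ∈ G.neighborFinset i, v j := by
    unfold rwAverage
    congr!
  rw [hsum, ← Finset.sum_filter, ← Finset.sum_mul, ← G.neighborFinset_eq_filter]
  by_cases h0 : G.degree i = 0
  · have : G.neighborFinset i = ∅ := Finset.card_eq_zero.1 h0
    simp [this]
  · have h0' : (G.degree i : ℝ) ≠ 0 := by exact_mod_cast h0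
    field_simp

theorem rwOp_isMarkovGraphop (G : SimpleGraph V) [IsProbabilityMeasure (rwMeasure G)] :
    (rwOp G).IsMarkovGraphop where
  positivityPreserving := by
    classical
    intro v hv
    rw [ae_rwMeasure_iff] at hv
    filter_upwards [rwOp_apply G v] with i hi
    rw [hi]
    refine mul_nonneg (by positivity) (Finset.sum_nonneg fun j hj => ?_)
    -- A neighbour j of i has an edge and hence positive mass, so the almost everywhere hypothesis
    -- holds at j.
    exact hv j i (((G.mem_neighborFinset i j).1 hj).symm)
  selfAdjoint := by
    classical
    intro v w
    rw [rwOp_form, rwOp_form, Finset.sum_comm]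
    congr 1
    refine Finset.sum_congr rfl fun i _ => Finset.sum_congr rfl fun j _ => ?_
    simp only [G.adj_comm j i, mul_comm]
  regular := by
    classical
    refine Lp.ext ?_
    have h1 := rwOp_apply G (Lp.const ∞ (rwMeasure G) 1)
    rw [rwAverage_congr G (coeFn_LpConst (μ := rwMeasure G) ∞ 1)] at h1
    have h2 : ∀ᵐ i ∂rwMeasure G, rwAverage G (fun _ => 1) i = 1 := by
      rw [ae_rwMeasure_iff]
      intro i j hij
      have h0 : 0 < G.degree i := (G.degree_pos_iff_exists_adj i).2 ⟨j, hij⟩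
      have h0' : (G.degree i : ℝ) ≠ 0 := by exact_mod_cast h0.ne'
      unfold rwAverage
      rw [Finset.sum_const, SimpleGraph.card_neighborFinset_eq_degree, nsmul_one]
      convert inv_mul_cancel₀ h0'
    filter_upwards [h1, h2, coeFn_LpConst (μ := rwMeasure G) 1 1] with i h1 h2 h3
    rw [h1, h2, h3]

end RandomWalk

theorem randomWalk_isMarkovGraphop {V : Type u} [Fintype V] (G : SimpleGraph V)
    (hG : G.edgeSet.Nonempty) : (randomWalk G hG).IsMarkovGraphop := by
  let _ : MeasurableSpace V := ⊤
  have : DiscreteMeasurableSpace V := ⟨fun _ => trivial⟩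
  have := rwMeasure_isProbability G hG
  exact rwOp_isMarkovGraphop G

theorem theorem3p5 :
    IsCompact markovClasses.{u} ∧
    ∀ (V : ℕ → Type u) [∀ i, Fintype (V i)] (G : ∀ i, SimpleGraph (V i))
      (hG : ∀ i, (G i).edgeSet.Nonempty),
      (∃ φ : ℕ → ℕ, StrictMono φ ∧
        ActionConvergent fun i => randomWalk (G (φ i)) (hG (φ i))) ∧
      ((ActionConvergent fun i => randomWalk (G i) (hG i)) →
        (∃ A : POperator.{u}, A.IsMarkovGraphop ∧
          Tendsto (fun i => dM (randomWalk (G i) (hG i)) A) atTop (𝓝 0)) ∧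
        ∀ A : POperator.{u},
          Tendsto (fun i => dM (randomWalk (G i) (hG i)) A) atTop (𝓝 0) →
            A.IsMarkovGraphop) := by
  refine ⟨isCompact_markovClasses, fun V _ G hG => ?_⟩
  have hM : ∀ i, (randomWalk (G i) (hG i)).IsMarkovGraphop :=
    fun i => randomWalk_isMarkovGraphop (G i) (hG i)
  obtain ⟨B, hB, φ, hφ, hlim⟩ := exists_subseq_tendsto_dM hM
  exact ⟨⟨φ, hφ, actionConvergent_of_tendsto hlim⟩, fun hconv =>
    ⟨⟨B, hB, tendsto_dM_of_subseq hconv hφ hlim⟩, fun A hA => isMarkovGraphop_of_tendsto_dM hM hA⟩⟩
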